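/- Consider the linear system $\dot x=Ax$, $x(t)\in\mathbb R^n$, and $m>0$ agents, agent $i$ measuring $y_i=C_ix\in\mathbb R^{s_i}$. Let $\mathcal V_i=\bigcap_{k=0}^{n-1}\ker(C_iA^k)$ be the unobservable space of $(C_i,A)$, let $P_i$ be the orthogonal projection of $\mathbb R^n$ onto $\mathcal V_i$, and let $V_i$ be a matrix whose columns form an orthonormal basis of $\mathcal V_i$. Assume that the system is jointly observable, i.e. $(C,A)$ is observable where $C$ is the matrix obtained by stacking $C_1,\dots,C_m$. The agents communicate over a fixed, strongly connected directed graph with a self-arc at every vertex; $\mathcal N_i$ is the set of all $j$ with an arc from $j$ to $i$ (so $i\in\mathcal N_i$) and $m_i=|\mathcal N_i|$. Fix $\lambda>0$. Call $K_i$ an admissible gain of agent $i$ if it arises as follows: $Q_i$ is a matrix of full row rank with $\ker Q_i=\mathcal V_i$; $\bar C_i,\bar A_i$ are the solutions of $\bar C_iQ_i=C_i$ and $Q_iA=\bar A_iQ_i$; $\bar K_i$ is a matrix such that $e^{(\bar A_i+\bar K_i\bar C_i)t}=O(e^{-\lambda t})$ for $t\ge 0$; and $K_i=Q_i^{-1}\bar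 K_i$ for a right inverse $Q_i^{-1}$ of $Q_i$. Admissible gains exist for every agent. Moreover, let $K_1,\dots,K_m$ be any admissible gains and consider the distributed estimator with adaptive local gains $$\dot x_i=(A+K_iC_i)x_i-K_iy_i-g_iP_i\Big(x_i-\frac1{m_i}\sum_{j\in\mathcal N_i}x_j\Big),\qquad \dot g_i=|V_i'W_ie|_2^2,\qquad i=1,\dots,m,$$ where $e_i=x_i-x$, $e=(e_1,\dots,e_m)$ is the estimation error, and $W_ie=\sum_{j\in\mathcal N_i}\frac1{m_i}(e_j-e_i)$. Then for all initial values $x(0),x_1(0),\dots,x_m(0)\in\mathbb R^n$ and $g_1(0),\dots,g_m(0)\ge 0$ there is a solution on $[0,\infty)$, and along every solution on $[0,\infty)$ with $g_1(0),\dots,g_m(0)\ge 0$ all gains $g_i$ are bounded on $[0,\infty)$ and $e(t)\to 0$ as $t\to\infty$. -/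

import Mathlib

open Filter Topology
open scoped Matrix

noncomputable section

namespace DistEst

/-- The linear map `v ↦ M v` between Euclidean spaces given by a real matrix `M`. -/
abbrev act {p q : Type*} [Fintype q] [DecidableEq q] (M : Matrix p q ℝ) :
    EuclideanSpace ℝ q →ₗ[ℝ] EuclideanSpace ℝ p :=
  Matrix.toLpLin 2 2 M

/-- The unobservable space of the pair `(C, A)`, `A` of size `n × n`: the kernel of the matrix
obtained by stacking `C, C A, …, C A ^ (n - 1)`. -/
def unobservableSpace {p : Type*} {n : ℕ} (C : Matrix p (Fin n) ℝ)
    (A : Matrix (Fin n) (Fin n) ℝ) : Submodule ℝ (EuclideanSpace ℝ (Fin n)) :=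
  ⨅ k : Fin n, LinearMap.ker (act (C * A ^ (k : ℕ)))

/-- Observability of the pair `(C, A)`. -/
def Observable {p : Type*} {n : ℕ} (C : Matrix p (Fin n) ℝ)
    (A : Matrix (Fin n) (Fin n) ℝ) : Prop :=
  unobservableSpace C A = ⊥

/-- The matrix `C = [C₁' C₂' ⋯ Cₘ']'` obtained by stacking the output matrices. -/
def stack {m n : ℕ} {s : Fin m → ℕ} (C : ∀ i, Matrix (Fin (s i)) (Fin n) ℝ) :
    Matrix (Σ i : Fin m, Fin (s i)) (Fin n) ℝ :=
  Matrix.of fun a b => C a.1 a.2 b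

/-- Joint observability of `ẋ = A x`, `yᵢ = Cᵢ x`. -/
def JointlyObservable {m n : ℕ} {s : Fin m → ℕ} (C : ∀ i, Matrix (Fin (s i)) (Fin n) ℝ)
    (A : Matrix (Fin n) (Fin n) ℝ) : Prop :=
  Observable (stack C) A

/-- `exp (t M)` converges to zero as `t → ∞` as fast as `exp (-lam t)` does. -/
def ExpDecay {r : ℕ} (M : Matrix (Fin r) (Fin r) ℝ) (lam : ℝ) : Prop :=
  ∃ c : ℝ, ∀ t : ℝ, 0 ≤ t → ∀ a b, |NormedSpace.exp (t • M) a b| ≤ c * Real.exp (-lam * t)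

/-- `K` is an output-injection gain for `(C, A)` obtained from the design with rate `lam`:
`Q` has full row rank and its kernel is the unobservable space of `(C, A)`; `Cbar`, `Abar` are
the solutions of `Cbar Q = C`, `Q A = Abar Q`; `Kbar` is such that `exp (t (Abar + Kbar Cbar))`
decays as fast as `exp (-lam t)`; and `K = Qinv Kbar` for a right inverse `Qinv` of `Q`. -/
def IsObserverGain {p n : ℕ} (C : Matrix (Fin p) (Fin n) ℝ) (A : Matrix (Fin n) (Fin n) ℝ)
    (lam : ℝ) (K : Matrix (Fin n) (Fin p) ℝ) : Prop :=
  ∃ (r : ℕ) (Q : Matrix (Fin r) (Fin n) ℝ) (Cbar : Matrix (Fin p) (Fin r) ℝ)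
    (Abar : Matrix (Fin r) (Fin r) ℝ) (Kbar : Matrix (Fin r) (Fin p) ℝ)
    (Qinv : Matrix (Fin n) (Fin r) ℝ),
    Q.rank = r ∧
    LinearMap.ker (act Q) = unobservableSpace C A ∧
    Cbar * Q = C ∧
    Q * A = Abar * Q ∧
    ExpDecay (Abar + Kbar * Cbar) lam ∧
    Q * Qinv = 1 ∧
    K = Qinv * Kbar

/-- The columns of `V` form an orthonormal basis of the subspace `U`. -/
def IsOrthonormalBasisMatrix {n d : ℕ} (V : Matrix (Fin n) (Fin d) ℝ)
    (U : Submodule ℝ (EuclideanSpace ℝ (Fin n))) : Prop :=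
  Orthonormal ℝ (fun k : Fin d => WithLp.toLp 2 (fun a => V a k)) ∧
  Submodule.span ℝ (Set.range fun k : Fin d => WithLp.toLp 2 (fun a => V a k)) = U

/-- Every vertex can be reached from every vertex along arcs. -/
def StronglyConnected {m : ℕ} (N : Digraph (Fin m)) : Prop :=
  ∀ i j, Relation.ReflTransGen N.Adj i j

open Classical in
/-- The labels of agent `i`'s neighbors: those `j` with an arc from `j` to `i`. -/
def neighbors {m : ℕ} (N : Digraph (Fin m)) (i : Fin m) : Finset (Fin m) :=
  Finset.univ.filter fun j => N.Adj j i

/-- `(x, ξ, g)` is a trajectory on `[0, ∞)` of the plant `ẋ = A x` with outputs `yᵢ = Cᵢ x`,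
the estimators
`ξᵢ' = (A + Kᵢ Cᵢ) ξᵢ - Kᵢ yᵢ - gᵢ Pᵢ (ξᵢ - (1 / mᵢ) ∑_{j ∈ Nᵢ} ξⱼ)`,
`Pᵢ` being the orthogonal projection on the unobservable space of `(Cᵢ, A)`, and the adaptive gains
`gᵢ' = |Vᵢᵀ ∑_{j ∈ Nᵢ} (1 / mᵢ) (eⱼ - eᵢ)|²` with `eᵢ = ξᵢ - x`. -/
structure IsAdaptiveTrajectory {m n : ℕ} {s d : Fin m → ℕ}
    (A : Matrix (Fin n) (Fin n) ℝ) (C : ∀ i, Matrix (Fin (s i)) (Fin n) ℝ)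
    (N : Digraph (Fin m)) (V : ∀ i, Matrix (Fin n) (Fin (d i)) ℝ)
    (K : ∀ i, Matrix (Fin n) (Fin (s i)) ℝ)
    (x : ℝ → EuclideanSpace ℝ (Fin n)) (ξ : Fin m → ℝ → EuclideanSpace ℝ (Fin n))
    (g : Fin m → ℝ → ℝ) : Prop where
  plant : ∀ t, 0 ≤ t → HasDerivWithinAt x (act A (x t)) (Set.Ici 0) t
  estimator : ∀ i t, 0 ≤ t → HasDerivWithinAt (ξ i)
    (act (A + K i * C i) (ξ i t) - act (K i) (act (C i) (x t))
      - g i t • (unobservableSpace (C i) A).starProjection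
          (ξ i t - ((neighbors N i).card : ℝ)⁻¹ • ∑ j ∈ neighbors N i, ξ j t))
    (Set.Ici 0) t
  gain : ∀ i t, 0 ≤ t → HasDerivWithinAt (g i)
    (‖act (V i)ᵀ (∑ j ∈ neighbors N i, ((neighbors N i).card : ℝ)⁻¹ •
        ((ξ j t - x t) - (ξ i t - x t)))‖ ^ 2)
    (Set.Ici 0) t

end DistEst

end

/-! In error coordinates the plant cancels and `e i' = (A + K i * C i) (e i) - g i • d i`, where `d
i` is the projection onto the unobservable space `U i` of the difference between `e i` and its
neighborhood average. The coupling lies in `U i`, so the component of `e i` orthogonal to `U i`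
decays exponentially whatever the gains do (`IsObserverGain.exists_decay`).

Strong connectivity gives positive stationary weights `p` for the averaging matrix. With them the
coupling form is a sum of squares along arcs, and joint observability, `⨅ i, U i = ⊥`, makes it
coercive up to the decaying components (`exists_coercive`).

Gains are nondecreasing because `g i' = ‖d i‖ ^ 2`. If some were unbounded, then from some time on
those would all be large. The Lyapunov function adds `p i * ‖P i (e i)‖ ^ 2 / g i + ε * g i` over
agents with unbounded gain, a negative multiple of `g i` over the others, and a decaying
exponential. It is nonincreasing, yet it dominates every unbounded gain: a contradiction
(`IsErrorTrajectory.gain_bounded`).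

Bounded gains make each `‖d i‖ ^ 2` integrable, and coercivity transfers this to the squared error.
As the latter grows at most exponentially, it tends to zero (`IsErrorTrajectory.tendsto_zero`). The
gain bound also holds on finite intervals, which excludes finite escape. Admissible gains come from
a finite-horizon observability Gramian (`exists_injection_exp_decay`). -/

namespace DistEst

/-! ### Uniqueness, continuation and global existence for autonomous equations. -/

open Set Metric in
/-- Two solutions of an autonomous equation that agree at time zero agree as long as both exist. -/
theorem solution_unique {E : Type*} [NormedAddCommGroup E] [NormedSpace ℝ E] {f : E → E}
    (hf : ∀ R : ℝ, ∃ L, LipschitzOnWith L f (closedBall 0 R)) {u v : ℝ → E} {J : Set ℝ}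
    (hJ : J.OrdConnected) (hJ0 : J ⊆ Ici 0) (h0J : (0 : ℝ) ∈ J)
    (hu : ∀ t ∈ J, HasDerivWithinAt u (f (u t)) (Ici 0) t)
    (hv : ∀ t ∈ J, HasDerivWithinAt v (f (v t)) (Ici 0) t) (h0 : u 0 = v 0) :
    EqOn u v J := by
  intro t ht
  have hsub : Icc 0 t ⊆ J := hJ.out h0J ht
  have huc : ContinuousOn u (Icc 0 t) := fun s hs =>
    (hu s (hsub hs)).continuousWithinAt.mono Icc_subset_Ici_self
  have hvc : ContinuousOn v (Icc 0 t) := fun s hs =>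
    (hv s (hsub hs)).continuousWithinAt.mono Icc_subset_Ici_self
  obtain ⟨R₁, h₁⟩ := isCompact_Icc.exists_bound_of_continuousOn huc
  obtain ⟨R₂, h₂⟩ := isCompact_Icc.exists_bound_of_continuousOn hvc
  obtain ⟨L, hL⟩ := hf (max R₁ R₂)
  refine ODE_solution_unique_of_mem_Icc_right (v := fun _ => f) (K := L)
    (s := fun _ => closedBall 0 (max R₁ R₂)) (fun _ _ => hL) huc
    (fun s hs => (hu s (hsub (Ico_subset_Icc_self hs))).mono (Ici_subset_Ici.2 hs.1)) ?_ hvc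
    (fun s hs => (hv s (hsub (Ico_subset_Icc_self hs))).mono (Ici_subset_Ici.2 hs.1)) ?_ h0
    ⟨hJ0 ht, le_rfl⟩
  · intro s hs
    simpa using Or.inl (h₁ s (Ico_subset_Icc_self hs))
  · intro s hs
    simpa using Or.inr (h₂ s (Ico_subset_Icc_self hs))

open Set Metric in
/-- A bounded solution can be continued beyond the end of its interval of definition. -/
theorem exists_continuation {E : Type*} [NormedAddCommGroup E] [NormedSpace ℝ E]
    [CompleteSpace E] {f : E → E}
    (hf : ∀ R : ℝ, ∃ L, LipschitzOnWith L f (closedBall 0 R)) (R : ℝ) :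
    ∃ ε > 0, ∀ (u : ℝ → E) (t₀ : ℝ), 0 ≤ t₀ →
      (∀ t ∈ Icc 0 t₀, HasDerivWithinAt u (f (u t)) (Icc 0 t₀) t) → ‖u t₀‖ ≤ R →
      ∃ v : ℝ → E, v 0 = u 0 ∧
        ∀ t ∈ Ico 0 (t₀ + ε), HasDerivWithinAt v (f (v t)) (Ici 0) t := by
  -- The unit ball about `u t₀` lies in the ball of radius `R + 1`, so the constants, and with them
  -- `ε`, depend on `R` alone.
  obtain ⟨L, hL⟩ := hf (R + 1)
  obtain ⟨M, hM⟩ : ∃ M : NNReal, ∀ x ∈ closedBall (0 : E) (R + 1), ‖f x‖ ≤ M := by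
    refine ⟨(‖f 0‖ + L * (R + 1)).toNNReal, fun x hx => le_trans ?_ (Real.le_coe_toNNReal _)⟩
    have hx' : ‖x‖ ≤ R + 1 := by simpa using hx
    have h1 := hL.norm_sub_le hx (y := 0) (by simpa using (norm_nonneg x).trans hx')
    have h2 : ‖f x‖ ≤ ‖f 0‖ + ‖f x - f 0‖ := norm_le_norm_add_norm_sub' _ _
    rw [sub_zero] at h1
    have h3 := mul_le_mul_of_nonneg_left hx' L.coe_nonneg
    linarith
  refine ⟨1 / (M + 1), by positivity, fun u t₀ ht₀ hu hR => ?_⟩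
  set ε : ℝ := 1 / (M + 1) with hε
  have hεpos : 0 < ε := by positivity
  have hball : closedBall (u t₀) 1 ⊆ closedBall (0 : E) (R + 1) := by
    apply closedBall_subset_closedBall'
    rw [dist_zero_right]; linarith
  have hP : IsPicardLindelof (fun _ => f) (tmin := t₀) (tmax := t₀ + ε)
      ⟨t₀, le_rfl, by linarith⟩ (u t₀) 1 0 M L := by
    refine IsPicardLindelof.of_time_independent (fun x hx => hM x (hball hx)) (hL.mono hball) ?_
    simp only [add_sub_cancel_left, sub_self, NNReal.coe_one, NNReal.coe_zero, sub_zero]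
    rw [max_eq_left hεpos.le, hε, mul_one_div, div_le_one (by positivity)]
    linarith
  obtain ⟨w, hw0, hw⟩ := hP.exists_eq_forall_mem_Icc_hasDerivWithinAt₀
  simp only at hw0
  refine ⟨fun t => if t ≤ t₀ then u t else w t, by simp [ht₀], fun t ht => ?_⟩
  have hvu : EqOn (fun t => if t ≤ t₀ then u t else w t) u (Icc 0 t₀) := fun s hs => by
    simp [hs.2]
  have hvw : EqOn (fun t => if t ≤ t₀ then u t else w t) w (Icc t₀ (t₀ + ε)) := fun s hs => by
    rcases hs.1.eq_or_lt with h | h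
    · subst h; simp [hw0]
    · simp [not_le.2 h]
  have key : HasDerivWithinAt (fun t => if t ≤ t₀ then u t else w t)
      (f ((fun t => if t ≤ t₀ then u t else w t) t)) (Icc 0 t₀ ∪ Icc t₀ (t₀ + ε)) t := by
    refine HasDerivWithinAt.union ?_ ?_
    · by_cases h : t ∈ Icc 0 t₀
      · rw [hvu h]
        exact (hu t h).congr hvu (hvu h)
      -- Off a closed interval, having a derivative within it is vacuous.
      · exact hasDerivWithinAt_iff_hasFDerivWithinAt.2
          (.of_notMem_closure (by rwa [isClosed_Icc.closure_eq]))
    · by_cases h : t ∈ Icc t₀ (t₀ + ε)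
      · rw [hvw h]
        exact (hw t h).congr hvw (hvw h)
      · exact hasDerivWithinAt_iff_hasFDerivWithinAt.2
          (.of_notMem_closure (by rwa [isClosed_Icc.closure_eq]))
  rw [Icc_union_Icc_eq_Icc ht₀ (by linarith)] at key
  refine key.mono_of_mem_nhdsWithin ?_
  rw [← Ici_inter_Iic]
  exact inter_mem_nhdsWithin _ (Iic_mem_nhds ht.2)

open Set Metric in
/-- If all solutions on bounded intervals are bounded, then there is a global solution. -/
theorem exists_global_solution {E : Type*} [NormedAddCommGroup E] [NormedSpace ℝ E]
    [CompleteSpace E] {f : E → E}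
    (hf : ∀ R : ℝ, ∃ L, LipschitzOnWith L f (closedBall 0 R)) (u₀ : E)
    (hb : ∀ (T : ℝ) (u : ℝ → E), 0 < T → u 0 = u₀ →
      (∀ t ∈ Ico 0 T, HasDerivWithinAt u (f (u t)) (Ici 0) t) →
      ∃ R, ∀ t ∈ Ico 0 T, ‖u t‖ ≤ R) :
    ∃ u : ℝ → E, u 0 = u₀ ∧ ∀ t, 0 ≤ t → HasDerivWithinAt u (f (u t)) (Ici 0) t := by
  set S : Set ℝ := {T | 0 < T ∧ ∃ u : ℝ → E, u 0 = u₀ ∧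
    ∀ t ∈ Ico 0 T, HasDerivWithinAt u (f (u t)) (Ici 0) t} with hS
  have hne : S.Nonempty := by
    obtain ⟨ε, hε, h⟩ := exists_continuation hf ‖u₀‖
    -- Local existence is continuation from the degenerate interval `[0, 0]`, on which any function
    -- counts as a solution.
    obtain ⟨v, hv0, hv⟩ := h (fun _ => u₀) 0 le_rfl (fun t ht => by
      simp only [Icc_self, mem_singleton_iff] at ht ⊢
      subst ht
      exact hasDerivWithinAt_iff_hasFDerivWithinAt.2 .singleton) le_rfl
    exact ⟨0 + ε, by simpa using hε, v, hv0, hv⟩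
  choose! u hu0 hu using fun T (hT : T ∈ S) => hT.2
  -- solutions on all of `{t | ∃ T ∈ S, t < T}`
  have glue : ∃ U : ℝ → E, U 0 = u₀ ∧
      ∀ T ∈ S, ∀ t ∈ Ico 0 T, HasDerivWithinAt U (f (U t)) (Ici 0) t := by
    have hτ : ∀ t, (∃ T ∈ S, t < T) → ∃ T ∈ S, t < T := fun _ h => h
    choose! τ hτS hτ using hτ
    have heq : ∀ T ∈ S, EqOn (fun t => u (τ t) t) (u T) (Ico 0 T) := by
      intro T hT t ht
      have h1 := hτS t ⟨T, hT, ht.2⟩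
      have h2 := hτ t ⟨T, hT, ht.2⟩
      refine solution_unique hf (J := Ico 0 (min T (τ t))) ordConnected_Ico (fun s hs => hs.1)
        ⟨le_rfl, lt_min hT.1 h1.1⟩ (fun s hs => hu _ h1 s ?_)
        (fun s hs => hu _ hT s ?_) ?_ ⟨ht.1, lt_min ht.2 h2⟩
      · exact ⟨hs.1, hs.2.trans_le (min_le_right _ _)⟩
      · exact ⟨hs.1, hs.2.trans_le (min_le_left _ _)⟩
      · rw [hu0 _ h1, hu0 _ hT]
    refine ⟨fun t => u (τ t) t, ?_, fun T hT t ht => ?_⟩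
    · obtain ⟨T, hT⟩ := hne
      rw [heq T hT ⟨le_rfl, hT.1⟩, hu0 _ hT]
    · have := (hu T hT t ht).congr_of_eventuallyEq (f₁ := fun t => u (τ t) t) ?_ (heq T hT ht)
      · rwa [← heq T hT ht] at this
      · have : Ico 0 T ∈ 𝓝[Ici 0] t := by
          rw [← Ici_inter_Iio]
          exact inter_mem_nhdsWithin _ (Iio_mem_nhds ht.2)
        filter_upwards [this] with s hs using heq T hT hs
  obtain ⟨U, hU0, hU⟩ := glue
  by_cases hbd : BddAbove S
  · exfalso
    have hpos : 0 < sSup S := by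
      obtain ⟨T, hT⟩ := hne
      exact hT.1.trans_le (le_csSup hbd hT)
    have hUs : ∀ t ∈ Ico 0 (sSup S), HasDerivWithinAt U (f (U t)) (Ici 0) t := by
      intro t ht
      obtain ⟨T, hT, htT⟩ := exists_lt_of_lt_csSup hne ht.2
      exact hU T hT t ⟨ht.1, htT⟩
    obtain ⟨R, hR⟩ := hb _ U hpos hU0 hUs
    obtain ⟨ε, hε, h⟩ := exists_continuation hf R
    -- Restarting within `ε / 2` of the supremum yields a solution that lasts beyond it.
    set t₀ := max 0 (sSup S - ε / 2) with ht₀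
    have h0 : 0 ≤ t₀ := le_max_left _ _
    have h1 : t₀ < sSup S := max_lt hpos (by linarith)
    obtain ⟨v, hv0, hv⟩ := h U t₀ h0
      (fun t ht => (hUs t ⟨ht.1, ht.2.trans_lt h1⟩).mono Icc_subset_Ici_self) (hR t₀ ⟨h0, h1⟩)
    have : t₀ + ε ≤ sSup S := le_csSup hbd ⟨by linarith, v, hv0.trans hU0, hv⟩
    have : sSup S - ε / 2 ≤ t₀ := le_max_right _ _
    linarith
  · refine ⟨U, hU0, fun t ht => ?_⟩
    obtain ⟨T, hT, htT⟩ := not_bddAbove_iff.1 hbd t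
    exact hU T hT t ⟨ht, htT⟩

/-! ### Stationary weights and coercivity of the coupling form. -/

/-- A row stochastic matrix with strongly connected graph has a positive left eigenvector for the
eigenvalue one. -/
theorem exists_pos_stationary {ι : Type*} [Fintype ι] [Nonempty ι] {S : ι → ι → ℝ}
    (hS : ∀ i j, 0 ≤ S i j) (hS1 : ∀ i, ∑ j, S i j = 1)
    (hconn : ∀ i j, Relation.ReflTransGen (fun a b => 0 < S b a) i j) :
    ∃ p : ι → ℝ, (∀ i, 0 < p i) ∧ ∀ j, ∑ i, p i * S i j = p j := by
  classical
  -- Unit row sums put the constant vector in the kernel; singularity then also provides a left null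
  -- vector.
  have hdet : (Matrix.of S - 1).det = 0 := by
    rw [← Matrix.exists_mulVec_eq_zero_iff]
    refine ⟨fun _ => 1, fun h => one_ne_zero (congrFun h (Classical.arbitrary ι)), ?_⟩
    ext i
    simp [Matrix.mulVec, dotProduct, hS1, Matrix.one_apply]
  obtain ⟨v, hv0, hv⟩ := Matrix.exists_vecMul_eq_zero_iff.2 hdet
  have hv' : ∀ j, ∑ i, v i * S i j = v j := by
    intro j
    have := congrFun hv j
    simp only [Matrix.vecMul_sub, Matrix.vecMul_one, Pi.sub_apply, Pi.zero_apply, sub_eq_zero] at this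
    simpa [Matrix.vecMul, dotProduct] using this
  have hle : ∀ j ∈ Finset.univ, |v j| ≤ ∑ i, |v i| * S i j := by
    intro j _
    conv_lhs => rw [← hv' j]
    refine (Finset.abs_sum_le_sum_abs _ _).trans_eq ?_
    simp [abs_mul, abs_of_nonneg (hS _ _)]
  -- Equal totals force equality in every triangle inequality `hle`, so `|v|` is itself stationary.
  have hsum : ∑ j, |v j| = ∑ j, ∑ i, |v i| * S i j := by
    rw [Finset.sum_comm]
    simp [← Finset.mul_sum, hS1]
  have heq := (Finset.sum_eq_sum_iff_of_le hle).1 hsum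
  obtain ⟨k, hk⟩ : ∃ k, v k ≠ 0 := Function.ne_iff.1 hv0
  refine ⟨fun i => |v i|, fun i => ?_, fun j => (heq j (Finset.mem_univ j)).symm⟩
  -- Positivity travels from `k` backwards along a path from `i` to `k`.
  refine Relation.ReflTransGen.head_induction_on (hconn i k) (abs_pos.2 hk) ?_
  intro a b hab _ hb
  beta_reduce at hb ⊢
  rw [heq a (Finset.mem_univ a)]
  exact (mul_pos hb hab).trans_le (Finset.single_le_sum (f := fun i => |v i| * S i a)
    (fun i _ => mul_nonneg (abs_nonneg _) (hS i a)) (Finset.mem_univ b))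

section Form

variable {ι E : Type*} [Fintype ι] [NormedAddCommGroup E] [InnerProductSpace ℝ E]

/-- The quadratic form of a stochastic matrix with stationary weights is a sum of squares of
differences along the arcs. -/
theorem sum_inner_sub_average {S : ι → ι → ℝ} (hS1 : ∀ i, ∑ j, S i j = 1) {p : ι → ℝ}
    (hp : ∀ j, ∑ i, p i * S i j = p j) (e : ι → E) :
    ∑ i, p i * inner ℝ (e i) (e i - ∑ j, S i j • e j)
      = (1 / 2) * ∑ i, ∑ j, p i * S i j * ‖e i - e j‖ ^ 2 := by
  -- When the square is expanded, both diagonal sums reduce to the same one: the first by unit row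
  -- sums, the second by stationarity.
  have h1 : ∑ i, ∑ j, p i * S i j * ‖e i‖ ^ 2 = ∑ i, p i * ‖e i‖ ^ 2 := by
    refine Finset.sum_congr rfl fun i _ => ?_
    rw [← Finset.sum_mul, ← Finset.mul_sum, hS1, mul_one]
  have h2 : ∑ i, ∑ j, p i * S i j * ‖e j‖ ^ 2 = ∑ i, p i * ‖e i‖ ^ 2 := by
    rw [Finset.sum_comm]
    refine Finset.sum_congr rfl fun i _ => ?_
    rw [← Finset.sum_mul, hp]
  have h3 : ∑ i, ∑ j, p i * S i j * ‖e i - e j‖ ^ 2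
      = ∑ i, ∑ j, p i * S i j * ‖e i‖ ^ 2 + ∑ i, ∑ j, p i * S i j * ‖e j‖ ^ 2
        - 2 * ∑ i, ∑ j, p i * (S i j * inner ℝ (e i) (e j)) := by
    simp only [Finset.mul_sum, ← Finset.sum_add_distrib, ← Finset.sum_sub_distrib]
    refine Finset.sum_congr rfl fun i _ => Finset.sum_congr rfl fun j _ => ?_
    rw [norm_sub_sq_real]
    ring
  rw [h3, h1, h2]
  simp only [inner_sub_right, inner_sum, inner_smul_right, real_inner_self_eq_norm_sq, mul_sub,
    Finset.sum_sub_distrib, ← Finset.mul_sum]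
  ring

theorem norm_sub_average_sq_le {S : ι → ι → ℝ} (hS : ∀ i j, 0 ≤ S i j)
    (hS1 : ∀ i, ∑ j, S i j = 1) (e : ι → E) (i : ι) :
    ‖e i - ∑ j, S i j • e j‖ ^ 2 ≤ 4 * ∑ j, ‖e j‖ ^ 2 := by
  set M := ∑ j, ‖e j‖ ^ 2 with hM
  have hM0 : 0 ≤ M := by positivity
  have he : ∀ j, ‖e j‖ ≤ √M := fun j => Real.le_sqrt_of_sq_le
    (Finset.single_le_sum (f := fun j => ‖e j‖ ^ 2) (fun _ _ => by positivity) (Finset.mem_univ j))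
  have h : ‖∑ j, S i j • e j‖ ≤ √M := by
    calc ‖∑ j, S i j • e j‖ ≤ ∑ j, ‖S i j • e j‖ := norm_sum_le _ _
      _ ≤ ∑ j, S i j * √M := by
        refine Finset.sum_le_sum fun j _ => ?_
        rw [norm_smul, Real.norm_of_nonneg (hS i j)]
        exact mul_le_mul_of_nonneg_left (he j) (hS i j)
      _ = √M := by rw [← Finset.sum_mul, hS1, one_mul]
  have h2 : ‖e i - ∑ j, S i j • e j‖ ≤ 2 * √M := by
    linarith [norm_sub_le (e i) (∑ j, S i j • e j), he i]
  calc _ ≤ (2 * √M) ^ 2 := by gcongr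
    _ = 4 * M := by rw [mul_pow, Real.sq_sqrt hM0]; norm_num

/-- The differences along the arcs of a strongly connected graph, together with the components
orthogonal to subspaces with zero intersection, control the whole vector. -/
theorem exists_le_differences [FiniteDimensional ℝ E] [Nonempty ι] {a : ι → ι → ℝ}
    (ha : ∀ i j, 0 ≤ a i j)
    (hconn : ∀ i j, Relation.ReflTransGen (fun k l => 0 < a l k) i j)
    (U : ι → Submodule ℝ E) (hU : ⨅ i, U i = ⊥) :
    ∃ c > 0, ∀ e : ι → E, c * ∑ i, ‖e i‖ ^ 2 ≤
      ∑ i, ∑ j, a i j * ‖e i - e j‖ ^ 2 + ∑ i, ‖e i - (U i).starProjection (e i)‖ ^ 2 := by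
  -- The right-hand side is the sum of the squared norms of the components of `T e`. In finite
  -- dimension an injective `T` is bounded below.
  let T : (ι → E) →ₗ[ℝ] (ι → ι → E) × (ι → E) :=
    { toFun := fun e => (fun i j => √(a i j) • (e i - e j),
        fun i => e i - (U i).starProjection (e i))
      map_add' := fun x y => by
        ext <;> simp only [Pi.add_apply, Prod.mk_add_mk, map_add]
        · module
        · module
      map_smul' := fun r x => by
        ext <;> simp only [Pi.smul_apply, Prod.smul_mk, map_smul, RingHom.id_apply]
        · module
        · module }
  have hT1 : ∀ e i j, (T e).1 i j = √(a i j) • (e i - e j) := fun _ _ _ => rfl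
  have hT2 : ∀ e i, (T e).2 i = e i - (U i).starProjection (e i) := fun _ _ => rfl
  have hker : LinearMap.ker T = ⊥ := by
    rw [LinearMap.ker_eq_bot']
    intro e he
    have hmem : ∀ i, e i ∈ U i := fun i => by
      have h := hT2 e i
      rw [he, Prod.snd_zero, Pi.zero_apply, eq_comm, sub_eq_zero] at h
      rw [h]
      exact Submodule.starProjection_apply_mem _ _
    have hstep : ∀ k l, 0 < a l k → e l = e k := fun k l hkl => by
      have h := hT1 e l k
      rw [he, Prod.fst_zero, Pi.zero_apply, Pi.zero_apply, eq_comm, smul_eq_zero, sub_eq_zero] at h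
      exact h.resolve_left (Real.sqrt_pos.2 hkl).ne'
    -- A kernel vector is constant along paths, so its common value lies in every `U j`.
    have hall : ∀ i j, e j = e i := fun i j => by
      induction hconn i j with
      | refl => rfl
      | tail _ h ih => exact (hstep _ _ h).trans ih
    ext1 i
    have : e i ∈ ⨅ j, U j := by
      rw [Submodule.mem_iInf]
      intro j
      rw [hall j i]
      exact hmem j
    rwa [hU, Submodule.mem_bot] at this
  obtain ⟨K, hK, hKT⟩ := T.exists_antilipschitzWith hker
  have hK0 : (0 : ℝ) < K := hK
  have hm : (0 : ℝ) < Fintype.card ι := by exact_mod_cast Fintype.card_pos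
  -- The product spaces carry the sup norm; the cardinality converts it to a sum of squares.
  refine ⟨1 / (Fintype.card ι * (K : ℝ) ^ 2), by positivity, fun e => ?_⟩
  set R := ∑ i, ∑ j, a i j * ‖e i - e j‖ ^ 2 + ∑ i, ‖e i - (U i).starProjection (e i)‖ ^ 2 with hR
  have hA : 0 ≤ ∑ i, ∑ j, a i j * ‖e i - e j‖ ^ 2 :=
    Finset.sum_nonneg fun i _ => Finset.sum_nonneg fun j _ => mul_nonneg (ha i j) (sq_nonneg _)
  have hB : 0 ≤ ∑ i, ‖e i - (U i).starProjection (e i)‖ ^ 2 := by positivity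
  have hR0 : 0 ≤ R := add_nonneg hA hB
  have hTe : ‖T e‖ ≤ √R := by
    rw [Prod.norm_def, max_le_iff, pi_norm_le_iff_of_nonneg (Real.sqrt_nonneg _),
      pi_norm_le_iff_of_nonneg (Real.sqrt_nonneg _)]
    constructor
    · intro i
      rw [pi_norm_le_iff_of_nonneg (Real.sqrt_nonneg _)]
      intro j
      rw [hT1]
      apply Real.le_sqrt_of_sq_le
      rw [norm_smul, mul_pow, Real.norm_of_nonneg (Real.sqrt_nonneg _), Real.sq_sqrt (ha i j)]
      have h1 := Finset.single_le_sum (f := fun j => a i j * ‖e i - e j‖ ^ 2)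
        (fun j _ => mul_nonneg (ha i j) (sq_nonneg _)) (Finset.mem_univ j)
      have h2 := Finset.single_le_sum (f := fun i => ∑ j, a i j * ‖e i - e j‖ ^ 2)
        (fun i _ => Finset.sum_nonneg fun j _ => mul_nonneg (ha i j) (sq_nonneg _))
        (Finset.mem_univ i)
      linarith
    · intro i
      rw [hT2]
      apply Real.le_sqrt_of_sq_le
      have h1 := Finset.single_le_sum (f := fun i => ‖e i - (U i).starProjection (e i)‖ ^ 2)
        (fun j _ => sq_nonneg _) (Finset.mem_univ i)
      linarith
  have he : ‖e‖ ≤ K * √R := by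
    have := hKT.le_mul_dist e 0
    rw [map_zero, dist_zero_right, dist_zero_right] at this
    exact this.trans (mul_le_mul_of_nonneg_left hTe hK0.le)
  have hsq : ‖e‖ ^ 2 ≤ (K : ℝ) ^ 2 * R := by
    calc ‖e‖ ^ 2 ≤ (K * √R) ^ 2 := by gcongr
      _ = _ := by rw [mul_pow, Real.sq_sqrt hR0]
  have hsum : ∑ i, ‖e i‖ ^ 2 ≤ Fintype.card ι * ‖e‖ ^ 2 := by
    calc ∑ i, ‖e i‖ ^ 2 ≤ ∑ _i : ι, ‖e‖ ^ 2 :=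
          Finset.sum_le_sum fun i _ => by gcongr; exact norm_le_pi_norm e i
      _ = _ := by simp
  rw [one_div, inv_mul_le_iff₀ (by positivity)]
  calc _ ≤ _ := hsum
    _ ≤ Fintype.card ι * ((K : ℝ) ^ 2 * R) := by gcongr
    _ = _ := by ring

/-- Without the projections, the form is half the sum over arcs, bounded below by
`exists_le_differences`. Inserting them costs an inner product with the component of `e i`
orthogonal to `U i`; Young's inequality charges that cost to `D` and to a fraction of the coercivity
constant. -/
theorem exists_coercive [FiniteDimensional ℝ E] [Nonempty ι] {S : ι → ι → ℝ}
    (hS : ∀ i j, 0 ≤ S i j) (hS1 : ∀ i, ∑ j, S i j = 1)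
    (hconn : ∀ i j, Relation.ReflTransGen (fun a b => 0 < S b a) i j)
    (U : ι → Submodule ℝ E) (hU : ⨅ i, U i = ⊥) :
    ∃ p : ι → ℝ, (∀ i, 0 < p i) ∧ ∃ c > 0, ∃ D, 0 ≤ D ∧ ∀ e : ι → E,
      c * ∑ i, ‖e i‖ ^ 2 ≤
        ∑ i, p i * inner ℝ ((U i).starProjection (e i))
          ((U i).starProjection (e i - ∑ j, S i j • e j))
        + D * ∑ i, ‖e i - (U i).starProjection (e i)‖ ^ 2 := by
  obtain ⟨p, hp0, hp⟩ := exists_pos_stationary hS hS1 hconn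
  obtain ⟨c, hc, hce⟩ := exists_le_differences (a := fun i j => p i * S i j)
    (fun i j => mul_nonneg (hp0 i).le (hS i j))
    (fun i j => Relation.ReflTransGen.mono (fun k l h => mul_pos (hp0 l) h) _ _ (hconn i j)) U hU
  set μ : ℝ := (Fintype.card ι : ℝ) with hμ
  have hμ0 : 0 < μ := by simp only [hμ]; exact_mod_cast Fintype.card_pos
  -- Chosen so that `ε * ∑ i, ‖y i‖ ^ 2` consumes only `c / 4` of the available `c / 2`.
  set ε := c / (16 * μ) with hε
  have hε0 : 0 < ε := by positivity
  set Q := ∑ i, p i ^ 2 with hQ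
  refine ⟨p, hp0, c / 4, by positivity, 1 / 2 + Q / (4 * ε), by positivity, fun e => ?_⟩
  set δ : ι → E := fun i => e i - (U i).starProjection (e i) with hδ
  set y : ι → E := fun i => e i - ∑ j, S i j • e j with hy
  have h1 : ∀ i, p i * inner ℝ (e i) (y i) - (ε * ‖y i‖ ^ 2 + Q / (4 * ε) * ‖δ i‖ ^ 2)
      ≤ p i * inner ℝ ((U i).starProjection (e i)) ((U i).starProjection (y i)) := by
    intro i
    have ha : inner ℝ ((U i).starProjection (e i)) ((U i).starProjection (y i))
        = inner ℝ (e i) (y i) - inner ℝ (δ i) (y i) := by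
      rw [← Submodule.inner_starProjection_left_eq_right,
        Submodule.starProjection_eq_self_iff.2 (Submodule.starProjection_apply_mem _ _),
        ← inner_sub_left, hδ]
      simp
    have hb : p i * inner ℝ (δ i) (y i) ≤ p i * (‖δ i‖ * ‖y i‖) :=
      mul_le_mul_of_nonneg_left (real_inner_le_norm _ _) (hp0 i).le
    have hq : p i ^ 2 ≤ Q := Finset.single_le_sum (f := fun i => p i ^ 2)
      (fun _ _ => sq_nonneg _) (Finset.mem_univ i)
    have hd : p i * (‖δ i‖ * ‖y i‖) ≤ ε * ‖y i‖ ^ 2 + p i ^ 2 / (4 * ε) * ‖δ i‖ ^ 2 := by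
      have h : ε * ‖y i‖ ^ 2 + p i ^ 2 / (4 * ε) * ‖δ i‖ ^ 2 - p i * (‖δ i‖ * ‖y i‖)
          = (2 * ε * ‖y i‖ - p i * ‖δ i‖) ^ 2 / (4 * ε) := by
        field_simp
        ring
      have : 0 ≤ (2 * ε * ‖y i‖ - p i * ‖δ i‖) ^ 2 / (4 * ε) := by positivity
      linarith
    have hf : p i ^ 2 / (4 * ε) * ‖δ i‖ ^ 2 ≤ Q / (4 * ε) * ‖δ i‖ ^ 2 := by gcongr
    rw [ha, mul_sub]
    linarith
  have h2 := Finset.sum_le_sum fun i (_ : i ∈ Finset.univ) => h1 i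
  rw [Finset.sum_sub_distrib, Finset.sum_add_distrib, ← Finset.mul_sum, ← Finset.mul_sum,
    sum_inner_sub_average hS1 hp] at h2
  have h3 : ∑ i, ‖y i‖ ^ 2 ≤ μ * (4 * ∑ i, ‖e i‖ ^ 2) := by
    refine (Finset.sum_le_sum fun i _ => norm_sub_average_sq_le hS hS1 e i).trans_eq ?_
    simp [hμ]
  have h4 : ε * ∑ i, ‖y i‖ ^ 2 ≤ c / 4 * ∑ i, ‖e i‖ ^ 2 := by
    refine (mul_le_mul_of_nonneg_left h3 hε0.le).trans_eq ?_
    rw [hε]; field_simp; ring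
  have h5 := hce e
  rw [add_mul]
  linarith

end Form

-- At interior points of the interval the derivative within `[0, ∞)` is two-sided; at end points
-- continuity suffices.
open Set in
theorem antitoneOn_of_hasDerivWithinAt_nonpos {J : Set ℝ} (hJ : J.OrdConnected) (hJ0 : J ⊆ Ici 0)
    {t₀ : ℝ} {f f' : ℝ → ℝ}
    (hf : ∀ t ∈ J, t₀ ≤ t → HasDerivWithinAt f (f' t) (Ici 0) t)
    (hf' : ∀ t ∈ J, t₀ ≤ t → f' t ≤ 0) : AntitoneOn f (J ∩ Ici t₀) := by
  have hconv : Convex ℝ (J ∩ Ici t₀) := hJ.convex.inter (convex_Ici t₀)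
  have hat : ∀ t ∈ interior (J ∩ Ici t₀), HasDerivAt f (f' t) t := by
    intro t ht
    have hmem := interior_subset ht
    refine (hf t hmem.1 hmem.2).hasDerivAt ?_
    exact mem_of_superset (mem_interior_iff_mem_nhds.1 ht) fun s hs => hJ0 hs.1
  refine antitoneOn_of_deriv_nonpos hconv (fun t ht => ?_)
    (fun t ht => (hat t ht).differentiableAt.differentiableWithinAt) fun t ht => ?_
  · exact (hf t ht.1 ht.2).continuousWithinAt.mono (inter_subset_left.trans hJ0)
  · rw [(hat t ht).deriv]
    exact hf' t (interior_subset ht).1 (interior_subset ht).2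

/-! ### Error dynamics and boundedness of the adaptive gains. -/

section Error

variable {ι E : Type*} [Fintype ι] [NormedAddCommGroup E] [InnerProductSpace ℝ E]
  [FiniteDimensional ℝ E]

/-- The projected disagreement of agent `i`. -/
noncomputable def disagreement (S : ι → ι → ℝ) (U : ι → Submodule ℝ E) (e : ι → E) (i : ι) : E :=
  (U i).starProjection (e i - ∑ j, S i j • e j)

/-- Estimation errors and adaptive gains on a time interval `J`. -/
structure IsErrorTrajectory (S : ι → ι → ℝ) (U : ι → Submodule ℝ E) (F : ι → E →L[ℝ] E)
    (J : Set ℝ) (e : ℝ → ι → E) (g : ℝ → ι → ℝ) : Prop where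
  error : ∀ i, ∀ t ∈ J, HasDerivWithinAt (fun t => e t i)
    (F i (e t i) - g t i • disagreement S U (e t) i) (Set.Ici 0) t
  gain : ∀ i, ∀ t ∈ J, HasDerivWithinAt (fun t => g t i)
    (‖disagreement S U (e t) i‖ ^ 2) (Set.Ici 0) t

variable {S : ι → ι → ℝ} {U : ι → Submodule ℝ E} {F : ι → E →L[ℝ] E} {J : Set ℝ}
  {e : ℝ → ι → E} {g : ℝ → ι → ℝ}

theorem norm_disagreement_sq_le (hS : ∀ i j, 0 ≤ S i j) (hS1 : ∀ i, ∑ j, S i j = 1)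
    (e : ι → E) (i : ι) : ‖disagreement S U e i‖ ^ 2 ≤ 4 * ∑ j, ‖e j‖ ^ 2 := by
  refine le_trans ?_ (norm_sub_average_sq_le hS hS1 e i)
  gcongr
  exact Submodule.norm_starProjection_apply_le _ _

theorem IsErrorTrajectory.gain_monotoneOn (h : IsErrorTrajectory S U F J e g)
    (hJ : J.OrdConnected) (hJ0 : J ⊆ Set.Ici 0) (i : ι) : MonotoneOn (fun t => g t i) J := by
  have := antitoneOn_of_hasDerivWithinAt_nonpos hJ hJ0 (t₀ := 0) (f := fun t => -g t i)
    (fun t ht _ => (h.gain i t ht).neg) (fun t _ _ => by simp only [Left.neg_nonpos_iff]; positivity)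
  rw [Set.inter_eq_self_of_subset_left hJ0] at this
  intro a ha b hb hab
  simpa using this ha hb hab

theorem IsErrorTrajectory.gain_nonneg (h : IsErrorTrajectory S U F J e g)
    (hJ : J.OrdConnected) (hJ0 : J ⊆ Set.Ici 0) (h0 : (0 : ℝ) ∈ J) (hg : ∀ i, 0 ≤ g 0 i) (i : ι)
    {t : ℝ} (ht : t ∈ J) : 0 ≤ g t i :=
  (hg i).trans (h.gain_monotoneOn hJ hJ0 i h0 ht (hJ0 ht))

open Set in
/-- The derivative of the contribution of an agent with large gain to the Lyapunov function. -/
theorem IsErrorTrajectory.weighted_deriv (h : IsErrorTrajectory S U F J e g) {i : ι} {t : ℝ}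
    (ht : t ∈ J) {p c ε : ℝ} (hp : 0 < p) (hgpos : 0 < g t i)
    (hgF : 4 * p * ‖F i‖ ≤ c * g t i) :
    ∃ y, HasDerivWithinAt
      (fun t => p * (‖(U i).starProjection (e t i)‖ ^ 2 / g t i) + ε * g t i) y (Ici 0) t ∧
      y ≤ -2 * (p * inner ℝ ((U i).starProjection (e t i)) (disagreement S U (e t) i))
        + c / 2 * ‖e t i‖ ^ 2 + ε * ‖disagreement S U (e t) i‖ ^ 2 := by
  have hw := ((U i).starProjection.hasFDerivAt.comp_hasDerivWithinAt t (h.error i t ht)).norm_sq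
  have hd := ((hw.div (h.gain i t ht) hgpos.ne').const_mul p).add ((h.gain i t ht).const_mul ε)
  refine ⟨_, hd, ?_⟩
  simp only [Function.comp]
  set w := (U i).starProjection (e t i) with hwdef
  set d := disagreement S U (e t) i with hddef
  have hPd : inner ℝ w ((U i).starProjection (F i (e t i) - g t i • d))
      = inner ℝ w (F i (e t i)) - g t i * inner ℝ w d := by
    rw [← Submodule.inner_starProjection_left_eq_right,
      Submodule.starProjection_eq_self_iff.2 (Submodule.starProjection_apply_mem _ _),
      inner_sub_right, inner_smul_right]
  rw [hPd]
  have hwe : ‖w‖ ≤ ‖e t i‖ := Submodule.norm_starProjection_apply_le _ _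
  have hin : inner ℝ w (F i (e t i)) ≤ ‖F i‖ * ‖e t i‖ ^ 2 := by
    calc _ ≤ ‖w‖ * ‖F i (e t i)‖ := real_inner_le_norm _ _
      _ ≤ ‖e t i‖ * (‖F i‖ * ‖e t i‖) := by
        gcongr
        exact (F i).le_opNorm _
      _ = _ := by ring
  -- Division by the gain cancels it from the coupling term, and the growth of the gain contributes
  -- a term of favorable sign, dropped below.
  have hexp : p * ((2 * (inner ℝ w (F i (e t i)) - g t i * inner ℝ w d) * g t i
      - ‖w‖ ^ 2 * ‖d‖ ^ 2) / g t i ^ 2)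
      = 2 * p * inner ℝ w (F i (e t i)) / g t i - 2 * (p * inner ℝ w d)
        - p * (‖w‖ ^ 2 * ‖d‖ ^ 2) / g t i ^ 2 := by
    field_simp
  have h1 : 2 * p * inner ℝ w (F i (e t i)) / g t i ≤ c / 2 * ‖e t i‖ ^ 2 := by
    rw [div_le_iff₀ hgpos]
    have h2 := mul_le_mul_of_nonneg_left hin (by positivity : 0 ≤ 2 * p)
    have h3 := mul_le_mul_of_nonneg_right hgF (sq_nonneg ‖e t i‖)
    linarith
  have h2 : 0 ≤ p * (‖w‖ ^ 2 * ‖d‖ ^ 2) / g t i ^ 2 := by positivity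
  rw [hexp]
  linarith

/-- Young's inequality for the coupling term of an agent. -/
theorem mul_inner_disagreement_le (e : ι → E) (i : ι) {p c : ℝ} (hp : 0 < p) (hc : 0 < c) :
    2 * (p * inner ℝ ((U i).starProjection (e i)) (disagreement S U e i))
      ≤ c / 2 * ‖e i‖ ^ 2 + 2 * p ^ 2 / c * ‖disagreement S U e i‖ ^ 2 := by
  set d := disagreement S U e i
  have hwe : ‖(U i).starProjection (e i)‖ ≤ ‖e i‖ := Submodule.norm_starProjection_apply_le _ _
  have h1 : inner ℝ ((U i).starProjection (e i)) d ≤ ‖e i‖ * ‖d‖ :=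
    (real_inner_le_norm _ _).trans (by gcongr)
  have h2 := mul_le_mul_of_nonneg_left h1 hp.le
  have h3 : c / 2 * ‖e i‖ ^ 2 + 2 * p ^ 2 / c * ‖d‖ ^ 2 - 2 * (p * (‖e i‖ * ‖d‖))
      = (c * ‖e i‖ - 2 * p * ‖d‖) ^ 2 / (2 * c) := by
    field_simp
    ring
  have h4 : 0 ≤ (c * ‖e i‖ - 2 * p * ‖d‖) ^ 2 / (2 * c) := by positivity
  linarith

omit [InnerProductSpace ℝ E] [FiniteDimensional ℝ E] in
theorem sum_sq_le_of_decay {v : ι → E} {D s : ℝ} (h : ∀ i, ‖v i‖ ≤ D * Real.exp (-s)) :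
    ∑ i, ‖v i‖ ^ 2 ≤ Fintype.card ι * D ^ 2 * Real.exp (-(2 * s)) := by
  calc ∑ i, ‖v i‖ ^ 2 ≤ ∑ _i : ι, (D * Real.exp (-s)) ^ 2 :=
        Finset.sum_le_sum fun i _ => by gcongr; exact h i
    _ = _ := by
      rw [Finset.sum_const, Finset.card_univ, nsmul_eq_mul, mul_pow, ← Real.exp_nat_mul]
      push_cast
      rw [mul_neg, mul_assoc]

theorem hasDerivAt_exp_neg_two_mul (lam t : ℝ) :
    HasDerivAt (fun t => Real.exp (-(2 * (lam * t)))) (-(2 * lam) * Real.exp (-(2 * (lam * t)))) t := by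
  have h := (((hasDerivAt_id t).const_mul lam).const_mul 2).fun_neg.exp
  exact h.congr_deriv (by simp only [id]; ring)

open Set in
/-- The adaptive gains stay bounded on every interval of existence. -/
theorem IsErrorTrajectory.gain_bounded [Nonempty ι] (hS : ∀ i j, 0 ≤ S i j)
    (hS1 : ∀ i, ∑ j, S i j = 1)
    (hconn : ∀ i j, Relation.ReflTransGen (fun a b => 0 < S b a) i j) (hU : ⨅ i, U i = ⊥)
    (h : IsErrorTrajectory S U F J e g) (hJ : J.OrdConnected) (hJ0 : J ⊆ Ici 0)
    (h0 : (0 : ℝ) ∈ J) (hg : ∀ i, 0 ≤ g 0 i) {lam D : ℝ} (hlam : 0 < lam)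
    (hD : ∀ i, ∀ t ∈ J, ‖e t i - (U i).starProjection (e t i)‖ ≤ D * Real.exp (-(lam * t))) :
    ∃ B, ∀ i, ∀ t ∈ J, |g t i| ≤ B := by
  classical
  suffices H : ∀ i, ∃ B, ∀ t ∈ J, g t i ≤ B by
    choose B hB using H
    refine ⟨∑ i, |B i|, fun i t ht => ?_⟩
    rw [abs_of_nonneg (h.gain_nonneg hJ hJ0 h0 hg i ht)]
    exact ((hB i t ht).trans (le_abs_self _)).trans
      (Finset.single_le_sum (f := fun i => |B i|) (fun _ _ => abs_nonneg _) (Finset.mem_univ i))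
  by_contra hcon
  obtain ⟨k, hk⟩ := not_forall.1 hcon
  -- The agents with unbounded gain, supposed to exist.
  set B : Finset ι := Finset.univ.filter fun i => ¬ ∃ b, ∀ t ∈ J, g t i ≤ b with hB
  have hkB : k ∈ B := by simpa [hB] using hk
  obtain ⟨p, hp, c, hc, D₀, hD₀, hco⟩ := exists_coercive hS hS1 hconn U hU
  set m : ℝ := (Fintype.card ι : ℝ) with hm
  have hm0 : 0 < m := by simp only [hm]; exact_mod_cast Fintype.card_pos
  -- Small enough that `ε` times the total squared disagreement is at most `c / 2` times the squared
  -- error.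
  set ε : ℝ := c / (8 * m) with hε
  have hε0 : 0 < ε := by positivity
  -- a time after which all unbounded gains are large
  obtain ⟨t₀, ht₀J, ht₀⟩ : ∃ t₀ ∈ J, ∀ i ∈ B, 4 * p i * ‖F i‖ / c + 1 ≤ g t₀ i := by
    have : ∀ i, i ∈ B → ∃ t ∈ J, 4 * p i * ‖F i‖ / c + 1 ≤ g t i := by
      intro i hi
      have hi' := (Finset.mem_filter.1 hi).2
      push Not at hi'
      obtain ⟨t, ht, htg⟩ := hi' (4 * p i * ‖F i‖ / c + 1)
      exact ⟨t, ht, htg.le⟩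
    choose! τ hτJ hτ using this
    obtain ⟨i₀, hi₀, hmax⟩ := B.exists_max_image τ ⟨k, hkB⟩
    exact ⟨τ i₀, hτJ i₀ hi₀, fun i hi => (hτ i hi).trans
      (h.gain_monotoneOn hJ hJ0 i (hτJ i hi) (hτJ i₀ hi₀) (hmax i hi))⟩
  have hlarge : ∀ i ∈ B, ∀ t ∈ J, t₀ ≤ t → 4 * p i * ‖F i‖ / c + 1 ≤ g t i := fun i hi t ht htt =>
    (ht₀ i hi).trans (h.gain_monotoneOn hJ hJ0 i ht₀J ht htt)
  -- For an agent outside `B` the coupling cannot be dominated by its gain; the negative multiple of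
  -- `g` pays for it through `mul_inner_disagreement_le`, and remains bounded below because that
  -- gain is bounded.
  set φ : ι → ℝ → ℝ := fun i t => if i ∈ B then
    p i * (‖(U i).starProjection (e t i)‖ ^ 2 / g t i) + ε * g t i
    else -(2 * p i ^ 2 / c) * g t i with hφ
  -- The conditions on `t` sit under the existential so that `choose` yields a derivative function
  -- defined for all times.
  have hder : ∀ i t, ∃ y, t ∈ J → t₀ ≤ t → HasDerivWithinAt (φ i) y (Ici 0) t ∧
      y ≤ -2 * (p i * inner ℝ ((U i).starProjection (e t i)) (disagreement S U (e t) i))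
        + c / 2 * ‖e t i‖ ^ 2 + ε * ‖disagreement S U (e t) i‖ ^ 2 := by
    intro i t
    by_cases hcase : t ∈ J ∧ t₀ ≤ t
    swap
    · exact ⟨0, fun h1 h2 => absurd ⟨h1, h2⟩ hcase⟩
    obtain ⟨htJ, htt⟩ := hcase
    by_cases hi : i ∈ B
    · have hG := hlarge i hi t htJ htt
      have hnn : 0 ≤ 4 * p i * ‖F i‖ / c := by have := hp i; positivity
      obtain ⟨y, hy⟩ := h.weighted_deriv (i := i) (p := p i) (c := c) (ε := ε) htJ (hp i)
        (by linarith) (by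
          have : 4 * p i * ‖F i‖ / c ≤ g t i := by linarith
          rw [div_le_iff₀ hc] at this
          linarith)
      refine ⟨y, fun _ _ => ?_⟩
      simpa only [hφ, hi, if_true] using hy
    · refine ⟨-(2 * p i ^ 2 / c) * ‖disagreement S U (e t) i‖ ^ 2, fun _ _ => ⟨?_, ?_⟩⟩
      · simp only [hφ, hi, if_false]
        exact (h.gain i t htJ).const_mul _
      · have := mul_inner_disagreement_le (S := S) (U := U) (e t) i (hp i) hc
        have : 0 ≤ ε * ‖disagreement S U (e t) i‖ ^ 2 := by positivity
        linarith
  choose y hy using hder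
  -- With this factor the derivative of the exponential cancels exactly the bound on twice the
  -- coercivity defect.
  set Δ : ℝ := D₀ * (m * D ^ 2) / lam with hΔ
  have hanti := antitoneOn_of_hasDerivWithinAt_nonpos hJ hJ0 (t₀ := t₀)
    (f := fun t => ∑ i, φ i t + Δ * Real.exp (-(2 * (lam * t))))
    (f' := fun t => ∑ i, y i t + Δ * (-(2 * lam) * Real.exp (-(2 * (lam * t)))))
    (fun t ht htt => (HasDerivWithinAt.fun_sum fun i _ => (hy i t ht htt).1).add
      ((hasDerivAt_exp_neg_two_mul lam t).hasDerivWithinAt.const_mul Δ))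
    (by
      intro t ht htt
      have h1 := Finset.sum_le_sum fun i (_ : i ∈ Finset.univ) => (hy i t ht htt).2
      rw [Finset.sum_add_distrib, Finset.sum_add_distrib, ← Finset.mul_sum, ← Finset.mul_sum,
        ← Finset.mul_sum] at h1
      have h2 := hco (e t)
      have h3 := sum_sq_le_of_decay (fun i => hD i t ht)
      have h4 : ε * ∑ i, ‖disagreement S U (e t) i‖ ^ 2 ≤ c / 2 * ∑ i, ‖e t i‖ ^ 2 := by
        calc _ ≤ ε * ∑ _i : ι, 4 * ∑ j, ‖e t j‖ ^ 2 := by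
              gcongr with i
              exact norm_disagreement_sq_le hS hS1 _ _
          _ = _ := by
              rw [Finset.sum_const, Finset.card_univ, nsmul_eq_mul, ← hm, hε]
              field_simp
              ring
      have h5 := mul_le_mul_of_nonneg_left h3 hD₀
      have h6 : Δ * (-(2 * lam) * Real.exp (-(2 * (lam * t))))
          = -2 * (D₀ * (m * D ^ 2 * Real.exp (-(2 * (lam * t))))) := by
        rw [hΔ]; field_simp
      have h7 : 0 ≤ c * ∑ i, ‖e t i‖ ^ 2 := by positivity
      rw [h6]
      simp only [disagreement] at h1 h4 ⊢
      linarith)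
  -- the Lyapunov function dominates the unbounded gains
  have hlow : ∀ i, ∃ b, 0 ≤ b ∧ ∀ t ∈ J, t₀ ≤ t → -b ≤ φ i t := by
    intro i
    by_cases hi : i ∈ B
    · refine ⟨0, le_rfl, fun t ht _ => ?_⟩
      have := h.gain_nonneg hJ hJ0 h0 hg i ht
      have := hp i
      simp only [hφ, hi, if_true]
      rw [neg_zero]
      positivity
    · have hi' : ∃ b, ∀ t ∈ J, g t i ≤ b := by
        by_contra h'
        exact hi (Finset.mem_filter.2 ⟨Finset.mem_univ i, h'⟩)
      obtain ⟨b, hb⟩ := hi'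
      have hb0 : 0 ≤ b := (hg i).trans (hb 0 h0)
      have hq : 0 ≤ 2 * p i ^ 2 / c := by positivity
      refine ⟨2 * p i ^ 2 / c * b, by positivity, fun t ht _ => ?_⟩
      simp only [hφ, hi, if_false]
      have := mul_le_mul_of_nonneg_left (hb t ht) hq
      linarith
  choose b hb0 hb using hlow
  -- The first entry covers times before `t₀`, by monotonicity of the gain; the second comes from
  -- the Lyapunov function.
  refine hk ⟨max (g t₀ k) ((∑ i, φ i t₀ + Δ * Real.exp (-(2 * (lam * t₀))) + ∑ i, b i) / ε),
    fun t ht => ?_⟩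
  rcases le_total t t₀ with htt | htt
  · exact le_max_of_le_left (h.gain_monotoneOn hJ hJ0 k ht ht₀J htt)
  · refine le_max_of_le_right ?_
    rw [le_div_iff₀ hε0]
    have h1 := hanti ⟨ht₀J, self_mem_Ici⟩ ⟨ht, htt⟩ htt
    simp only at h1
    have hΔ0 : 0 ≤ Δ * Real.exp (-(2 * (lam * t))) := by positivity
    have h2 : ε * g t k ≤ φ k t + b k := by
      have := h.gain_nonneg hJ hJ0 h0 hg k ht
      have := hp k
      have h3 : 0 ≤ p k * (‖(U k).starProjection (e t k)‖ ^ 2 / g t k) := by positivity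
      have := hb0 k
      simp only [hφ, hkB, if_true]
      linarith
    have h3 : φ k t + b k ≤ ∑ i, (φ i t + b i) :=
      Finset.single_le_sum (f := fun i => φ i t + b i)
        (fun i _ => by linarith [hb i t ht htt]) (Finset.mem_univ k)
    rw [Finset.sum_add_distrib] at h3
    linarith

end Error

/-! ### Convergence of the errors once the gains are bounded. -/

section Error

variable {ι E : Type*} [Fintype ι] [NormedAddCommGroup E] [InnerProductSpace ℝ E]
  [FiniteDimensional ℝ E]
  {S : ι → ι → ℝ} {U : ι → Submodule ℝ E} {F : ι → E →L[ℝ] E} {J : Set ℝ}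
  {e : ℝ → ι → E} {g : ℝ → ι → ℝ}

open Set in
/-- While the gains are bounded, the squared error grows at most exponentially. -/
theorem IsErrorTrajectory.exists_energy_deriv_le (hS : ∀ i j, 0 ≤ S i j)
    (hS1 : ∀ i, ∑ j, S i j = 1) (h : IsErrorTrajectory S U F J e g) {B : ℝ}
    (hB : ∀ i, ∀ t ∈ J, |g t i| ≤ B) :
    ∃ L, 0 ≤ L ∧ ∃ y : ℝ → ℝ, ∀ t ∈ J,
      HasDerivWithinAt (fun t => ∑ i, ‖e t i‖ ^ 2) (y t) (Ici 0) t ∧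
      y t ≤ L * ∑ i, ‖e t i‖ ^ 2 := by
  set Φ := ∑ i, ‖F i‖ with hΦ
  have hΦ0 : 0 ≤ Φ := by positivity
  refine ⟨2 * Φ + |B| * (1 + 4 * Fintype.card ι), by positivity,
    fun t => ∑ i, 2 * inner ℝ (e t i) (F i (e t i) - g t i • disagreement S U (e t) i),
    fun t ht => ⟨HasDerivWithinAt.fun_sum fun i _ => (h.error i t ht).norm_sq, ?_⟩⟩
  have hterm : ∀ i, 2 * inner ℝ (e t i) (F i (e t i) - g t i • disagreement S U (e t) i)
      ≤ (2 * Φ + |B|) * ‖e t i‖ ^ 2 + |B| * (4 * ∑ j, ‖e t j‖ ^ 2) := by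
    intro i
    set d := disagreement S U (e t) i
    have hF : ‖F i‖ ≤ Φ :=
      Finset.single_le_sum (f := fun i => ‖F i‖) (fun _ _ => norm_nonneg _) (Finset.mem_univ i)
    have h1 : inner ℝ (e t i) (F i (e t i)) ≤ Φ * ‖e t i‖ ^ 2 := by
      calc _ ≤ ‖e t i‖ * ‖F i (e t i)‖ := real_inner_le_norm _ _
        _ ≤ ‖e t i‖ * (Φ * ‖e t i‖) := by
          gcongr
          exact ((F i).le_opNorm _).trans (by gcongr)
        _ = _ := by ring
    have h2 : |g t i * inner ℝ (e t i) d| ≤ |B| * (‖e t i‖ * ‖d‖) := by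
      rw [abs_mul]
      exact mul_le_mul ((hB i t ht).trans (le_abs_self B)) (abs_real_inner_le_norm _ _)
        (abs_nonneg _) (abs_nonneg _)
    have h3 : 2 * (‖e t i‖ * ‖d‖) ≤ ‖e t i‖ ^ 2 + 4 * ∑ j, ‖e t j‖ ^ 2 := by
      have := norm_disagreement_sq_le (U := U) hS hS1 (e t) i
      have := two_mul_le_add_sq ‖e t i‖ ‖d‖
      linarith
    have h4 := mul_le_mul_of_nonneg_left h3 (abs_nonneg B)
    have h5 := (abs_le.1 h2).1
    rw [inner_sub_right, inner_smul_right]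
    linarith
  refine (Finset.sum_le_sum fun i _ => hterm i).trans_eq ?_
  rw [Finset.sum_add_distrib, ← Finset.mul_sum, Finset.sum_const, Finset.card_univ, nsmul_eq_mul]
  ring

open Set in
/-- A function whose derivative is at most proportional to its value is bounded on bounded
intervals. -/
theorem le_mul_exp_of_hasDerivWithinAt_le (hJ : J.OrdConnected) (hJ0 : J ⊆ Ici 0)
    (h0 : (0 : ℝ) ∈ J) {f y : ℝ → ℝ} {L : ℝ}
    (hf : ∀ t ∈ J, HasDerivWithinAt f (y t) (Ici 0) t) (hy : ∀ t ∈ J, y t ≤ L * f t) {t : ℝ}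
    (ht : t ∈ J) : f t ≤ f 0 * Real.exp (L * t) := by
  have hd : ∀ t, HasDerivAt (fun t => Real.exp (-(L * t))) (-L * Real.exp (-(L * t))) t := by
    intro t
    have h := ((hasDerivAt_id t).const_mul L).fun_neg.exp
    exact h.congr_deriv (by simp only [id]; ring)
  have hanti := antitoneOn_of_hasDerivWithinAt_nonpos hJ hJ0 (t₀ := 0)
    (fun t ht _ => (hf t ht).mul (hd t).hasDerivWithinAt) (fun t ht _ => by
      have := mul_le_mul_of_nonneg_right (hy t ht) (Real.exp_nonneg (-(L * t)))
      linarith)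
  have h1 := hanti ⟨h0, self_mem_Ici⟩ ⟨ht, hJ0 ht⟩ (hJ0 ht)
  simp only [Pi.mul_apply, mul_zero, neg_zero, Real.exp_zero, mul_one] at h1
  rwa [Real.exp_neg, ← div_eq_mul_inv, div_le_iff₀ (Real.exp_pos _)] at h1

/-- An antitone function on `[0, ∞)` that is bounded below converges. -/
theorem exists_tendsto_of_antitoneOn {f : ℝ → ℝ} (hf : AntitoneOn f (Set.Ici 0)) {b : ℝ}
    (hb : ∀ t, 0 ≤ t → b ≤ f t) : ∃ l, Tendsto f atTop (𝓝 l) := by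
  have hanti : Antitone fun t => f (max t 0) := fun s t hst =>
    hf (le_max_right s 0) (le_max_right t 0) (max_le_max_right 0 hst)
  have hbd : BddBelow (Set.range fun t => f (max t 0)) :=
    ⟨b, by rintro _ ⟨t, rfl⟩; exact hb _ (le_max_right t 0)⟩
  refine ⟨_, (tendsto_atTop_ciInf hanti hbd).congr' ?_⟩
  filter_upwards [eventually_ge_atTop 0] with t ht
  rw [max_eq_left ht]

open Set in
/-- With bounded gains the errors converge to zero. -/
theorem IsErrorTrajectory.tendsto_zero [Nonempty ι] (hS : ∀ i j, 0 ≤ S i j)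
    (hS1 : ∀ i, ∑ j, S i j = 1)
    (hconn : ∀ i j, Relation.ReflTransGen (fun a b => 0 < S b a) i j) (hU : ⨅ i, U i = ⊥)
    (h : IsErrorTrajectory S U F (Ici 0) e g) {B : ℝ} (hB : ∀ i, ∀ t ∈ Ici (0 : ℝ), |g t i| ≤ B)
    {lam D : ℝ} (hlam : 0 < lam)
    (hD : ∀ i, ∀ t ∈ Ici (0 : ℝ),
      ‖e t i - (U i).starProjection (e t i)‖ ≤ D * Real.exp (-(lam * t))) :
    Tendsto e atTop (𝓝 0) := by
  obtain ⟨L, hL0, y, hy⟩ := h.exists_energy_deriv_le hS hS1 hB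
  obtain ⟨p, hp, c, hc, D₀, hD₀, hco⟩ := exists_coercive hS hS1 hconn U hU
  set N : ℝ → ℝ := fun t => ∑ i, ‖e t i‖ ^ 2 with hN
  set X : ℝ → ℝ := fun t => Real.exp (-(2 * (lam * t))) with hX
  have hN0 : ∀ t, 0 ≤ N t := fun t => by positivity
  have hX0 : Tendsto X atTop (𝓝 0) := by
    refine Real.tendsto_exp_neg_atTop_nhds_zero.comp ?_
    exact (tendsto_id.const_mul_atTop hlam).const_mul_atTop two_pos
  -- Coercivity and Young's inequality bound the squared error by the derivative of the total gain
  -- plus an exponential, both integrable.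
  obtain ⟨a, ha, b, hb0, hab⟩ : ∃ a > 0, ∃ b, 0 ≤ b ∧ ∀ t ∈ Ici (0 : ℝ),
      N t ≤ a * ∑ i, ‖disagreement S U (e t) i‖ ^ 2 + b * X t := by
    set Q := ∑ i, p i ^ 2 with hQ
    have hQ0 : 0 < Q := Finset.sum_pos (fun i _ => pow_pos (hp i) 2) Finset.univ_nonempty
    refine ⟨2 * Q / c ^ 2, by positivity, 2 * (D₀ * (Fintype.card ι * D ^ 2)) / c, by positivity,
      fun t ht => ?_⟩
    have h1 : ∀ i, p i * inner ℝ ((U i).starProjection (e t i)) (disagreement S U (e t) i)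
        ≤ c / 4 * ‖e t i‖ ^ 2 + Q / c * ‖disagreement S U (e t) i‖ ^ 2 := by
      intro i
      have h2 := mul_inner_disagreement_le (S := S) (U := U) (e t) i (hp i) hc
      have hq : p i ^ 2 ≤ Q := Finset.single_le_sum (f := fun i => p i ^ 2)
        (fun _ _ => sq_nonneg _) (Finset.mem_univ i)
      have h3 : 2 * p i ^ 2 / c * ‖disagreement S U (e t) i‖ ^ 2
          ≤ 2 * Q / c * ‖disagreement S U (e t) i‖ ^ 2 := by gcongr
      have h4 : 2 * Q / c * ‖disagreement S U (e t) i‖ ^ 2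
          = 2 * (Q / c * ‖disagreement S U (e t) i‖ ^ 2) := by ring
      linarith
    have h2 := Finset.sum_le_sum fun i (_ : i ∈ Finset.univ) => h1 i
    rw [Finset.sum_add_distrib, ← Finset.mul_sum, ← Finset.mul_sum] at h2
    have h3 := hco (e t)
    have h4 := mul_le_mul_of_nonneg_left (sum_sq_le_of_decay (fun i => hD i t ht)) hD₀
    have h5 : c / 2 * N t ≤ Q / c * ∑ i, ‖disagreement S U (e t) i‖ ^ 2
        + D₀ * (Fintype.card ι * D ^ 2 * X t) := by
      have h6 : 0 ≤ c * N t := mul_nonneg hc.le (hN0 t)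
      simp only [hN, hX, disagreement] at h2 h6 ⊢
      linarith
    have h6 : 2 * Q / c ^ 2 * ∑ i, ‖disagreement S U (e t) i‖ ^ 2
        + 2 * (D₀ * (Fintype.card ι * D ^ 2)) / c * X t
        = 2 / c * (Q / c * ∑ i, ‖disagreement S U (e t) i‖ ^ 2
        + D₀ * (Fintype.card ι * D ^ 2 * X t)) := by
      field_simp
    rw [h6]
    calc N t = 2 / c * (c / 2 * N t) := by field_simp
      _ ≤ _ := by gcongr
  have hder : ∀ t ∈ Ici (0 : ℝ), HasDerivWithinAt (fun t => ∑ i, g t i)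
      (∑ i, ‖disagreement S U (e t) i‖ ^ 2) (Ici 0) t := fun t ht =>
    HasDerivWithinAt.fun_sum fun i _ => h.gain i t ht
  have hgB : ∀ t ∈ Ici (0 : ℝ), ∑ i, g t i ≤ Fintype.card ι * B := by
    intro t ht
    calc ∑ i, g t i ≤ ∑ _i : ι, B :=
          Finset.sum_le_sum fun i _ => (le_abs_self _).trans (hB i t ht)
      _ = _ := by simp
  have hXnn : ∀ t, 0 ≤ X t := fun t => (Real.exp_pos _).le
  have hlimg : ∃ l, Tendsto (fun t => -∑ i, g t i) atTop (𝓝 l) := by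
    refine exists_tendsto_of_antitoneOn ?_ (b := -(Fintype.card ι * B))
      fun t ht => neg_le_neg (hgB t ht)
    have := antitoneOn_of_hasDerivWithinAt_nonpos ordConnected_Ici subset_rfl (t₀ := 0)
      (fun t ht _ => (hder t ht).fun_neg)
      (fun t _ _ => by rw [neg_nonpos]; positivity)
    rwa [inter_self] at this
  obtain ⟨lg, hlg⟩ := hlimg
  -- Since `N' ≤ L * N`, the two corrections absorb the bound `hab` and make the sum nonincreasing.
  -- Both converge, hence so does `N`.
  have hlimZ : ∃ l, Tendsto (fun t => N t + L * a * (-∑ i, g t i) + L * b / (2 * lam) * X t)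
      atTop (𝓝 l) := by
    refine exists_tendsto_of_antitoneOn ?_ (b := L * a * (-(Fintype.card ι * B))) fun t ht => ?_
    · have := antitoneOn_of_hasDerivWithinAt_nonpos ordConnected_Ici subset_rfl (t₀ := 0)
        (fun t ht _ => ((hy t ht).1.fun_add ((hder t ht).fun_neg.const_mul (L * a))).fun_add
          ((hasDerivAt_exp_neg_two_mul lam t).hasDerivWithinAt.const_mul (L * b / (2 * lam))))
        (fun t ht _ => by
          have h1 := (hy t ht).2
          have h2 := mul_le_mul_of_nonneg_left (hab t ht) hL0
          have h3 : L * b / (2 * lam) * (-(2 * lam) * Real.exp (-(2 * (lam * t))))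
              = -(L * (b * X t)) := by
            simp only [hX]
            field_simp
          rw [h3]
          linarith)
      rwa [inter_self] at this
    · have h1 := hN0 t
      have h2 := hXnn t
      have h3 : L * a * (-(Fintype.card ι * B)) ≤ L * a * (-∑ i, g t i) :=
        mul_le_mul_of_nonneg_left (neg_le_neg (hgB t ht)) (by positivity)
      have h4 : 0 ≤ L * b / (2 * lam) * X t := by positivity
      linarith
  obtain ⟨lZ, hlZ⟩ := hlimZ
  obtain ⟨l, hl⟩ : ∃ l, Tendsto N atTop (𝓝 l) := by
    refine ⟨_, ((hlZ.sub (hlg.const_mul (L * a))).sub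
      (hX0.const_mul (L * b / (2 * lam)))).congr fun t => ?_⟩
    ring
  have hl0 : 0 ≤ l := ge_of_tendsto' hl hN0
  -- A positive limit would make the total gain grow eventually at rate at least `l / (4 * a)`,
  -- against its boundedness.
  have hlz : l = 0 := by
    by_contra hne
    have hlpos : 0 < l := lt_of_le_of_ne hl0 (Ne.symm hne)
    have hev : ∀ᶠ t in atTop, l / 2 < N t ∧ b * X t < l / 4 := by
      refine (hl.eventually (lt_mem_nhds (by linarith))).and ?_
      have := hX0.const_mul b
      rw [mul_zero] at this
      exact this.eventually (gt_mem_nhds (by linarith))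
    obtain ⟨t₁, ht₁⟩ := eventually_atTop.1 hev
    set t₀ := max t₁ 0 with ht₀
    have hanti := antitoneOn_of_hasDerivWithinAt_nonpos ordConnected_Ici subset_rfl (t₀ := t₀)
      (fun t ht _ => ((hasDerivWithinAt_id t (Ici 0)).const_mul (l / (4 * a))).fun_sub (hder t ht))
      (fun t ht htt => by
        obtain ⟨h1, h2⟩ := ht₁ t ((le_max_left _ _).trans htt)
        have h3 := hab t ht
        have h4 : l / 4 ≤ a * ∑ i, ‖disagreement S U (e t) i‖ ^ 2 := by linarith
        rw [mul_one, sub_nonpos, div_le_iff₀ (by positivity)]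
        linarith)
    have ht₀0 : 0 ≤ t₀ := le_max_right _ _
    obtain ⟨n, hn⟩ := exists_nat_gt
      ((Fintype.card ι * B - ∑ i, g t₀ i) / (l / (4 * a)))
    rw [div_lt_iff₀ (by positivity)] at hn
    have hmem : t₀ + n ∈ Ici (0 : ℝ) := add_nonneg ht₀0 (Nat.cast_nonneg n)
    have hle : t₀ ≤ t₀ + n := le_add_of_nonneg_right (Nat.cast_nonneg n)
    have h1 := hanti ⟨ht₀0, self_mem_Ici⟩ ⟨hmem, hle⟩ hle
    have h2 := hgB _ hmem
    simp only [id] at h1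
    linarith
  rw [hlz] at hl
  rw [tendsto_pi_nhds]
  intro i
  rw [Pi.zero_apply, tendsto_zero_iff_norm_tendsto_zero]
  have hsq : Tendsto (fun t => ‖e t i‖ ^ 2) atTop (𝓝 0) :=
    squeeze_zero (fun _ => by positivity) (fun t => Finset.single_le_sum
      (f := fun i => ‖e t i‖ ^ 2) (fun _ _ => by positivity) (Finset.mem_univ i)) hl
  have := hsq.sqrt
  simpa [Real.sqrt_sq (norm_nonneg _)] using this

end Error

/-! ### Output injection with prescribed decay rate. -/

section Gramian

variable {G H : Type*} [NormedAddCommGroup G] [InnerProductSpace ℝ G] [FiniteDimensional ℝ G]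
  [NormedAddCommGroup H] [InnerProductSpace ℝ H] [FiniteDimensional ℝ H]

omit [FiniteDimensional ℝ H] in
theorem hasDerivAt_comp_exp_apply (Γ : G →L[ℝ] H) (N : G →L[ℝ] G) (z : G) (s : ℝ) :
    HasDerivAt (fun s : ℝ => Γ (NormedSpace.exp (s • N) z))
      (Γ (NormedSpace.exp (s • N) (N z))) s :=
  Γ.hasFDerivAt.comp_hasDerivAt s
    ((hasDerivAt_exp_smul_const N s).clm_apply (hasDerivAt_const s z) |>.congr_deriv (by simp))

theorem hasDerivAt_exp_apply (N : G →L[ℝ] G) (z : G) (s : ℝ) :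
    HasDerivAt (fun s : ℝ => NormedSpace.exp (s • N) z) (N (NormedSpace.exp (s • N) z)) s :=
  (hasDerivAt_exp_smul_const' N s).clm_apply (hasDerivAt_const s z) |>.congr_deriv (by simp)

omit [FiniteDimensional ℝ G] in
theorem exp_zero_smul_apply (N : G →L[ℝ] G) (z : G) :
    NormedSpace.exp ((0 : ℝ) • N) z = z := by
  simp

omit [FiniteDimensional ℝ H] in
open Set in
/-- An output of an observable system that vanishes on an interval forces the state to vanish. -/
theorem eq_zero_of_output_eq_zero {Γ : G →L[ℝ] H} {Λ : G →L[ℝ] G}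
    (hobs : ∀ z, (∀ k : ℕ, Γ ((Λ ^ k) z) = 0) → z = 0) (lam : ℝ) {z : G}
    (hz : ∀ s ∈ Icc (0 : ℝ) 1, Γ (NormedSpace.exp (s • (-(Λ + lam • 1))) z) = 0) : z = 0 := by
  set N : G →L[ℝ] G := -(Λ + lam • 1) with hN
  -- Differentiating the vanishing output shows that `N z`, and so `Λ z`, also has vanishing output.
  have hinv : ∀ z, (∀ s ∈ Icc (0 : ℝ) 1, Γ (NormedSpace.exp (s • N) z) = 0) →
      ∀ s ∈ Icc (0 : ℝ) 1, Γ (NormedSpace.exp (s • N) (Λ z)) = 0 := by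
    intro z hz s hs
    have h1 := (hasDerivAt_comp_exp_apply Γ N z s).hasDerivWithinAt (s := Icc 0 1)
    have h2 : HasDerivWithinAt (fun s : ℝ => Γ (NormedSpace.exp (s • N) z)) 0 (Icc 0 1) s :=
      (hasDerivWithinAt_const s (Icc 0 1) (0 : H)).congr hz (hz s hs)
    have h3 := (uniqueDiffOn_Icc zero_lt_one s hs).eq_deriv _ h1 h2
    have h4 : Λ z = -(N z) - lam • z := by simp [hN]
    rw [h4, map_sub, map_neg, map_smul, map_sub, map_neg, map_smul, h3, hz s hs]
    simp
  refine hobs z fun k => ?_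
  have hk : ∀ s ∈ Icc (0 : ℝ) 1, Γ (NormedSpace.exp (s • N) ((Λ ^ k) z)) = 0 := by
    induction k with
    | zero => simpa using hz
    | succ k ih =>
      rw [pow_succ']
      exact hinv _ ih
  simpa using hk 0 ⟨le_rfl, zero_le_one⟩

open Set in
/-- The finite-horizon observability Gramian of the shifted system. -/
theorem exists_gramian {Γ : G →L[ℝ] H} {Λ : G →L[ℝ] G}
    (hobs : ∀ z, (∀ k : ℕ, Γ ((Λ ^ k) z) = 0) → z = 0) (lam : ℝ) :
    ∃ W : G →L[ℝ] G, (∀ z w, inner ℝ (W z) w = inner ℝ z (W w)) ∧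
      (∀ z, z ≠ 0 → 0 < inner ℝ (W z) z) ∧
      ∀ z, 2 * inner ℝ (W z) ((Λ + lam • 1) z) ≤ ‖Γ z‖ ^ 2 := by
  set N : G →L[ℝ] G := -(Λ + lam • 1) with hN
  set Φ : ℝ → G →L[ℝ] G := fun s =>
    (Γ ∘L NormedSpace.exp (s • N)).adjoint ∘L (Γ ∘L NormedSpace.exp (s • N)) with hΦ
  have hexp : Continuous fun s : ℝ => NormedSpace.exp (s • N) :=
    (differentiable_exp_smul_const ℝ N).continuous
  have hΓexp : Continuous fun s : ℝ => Γ ∘L NormedSpace.exp (s • N) :=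
    continuous_const.clm_comp hexp
  have hcont : Continuous Φ :=
    (ContinuousLinearMap.adjoint.continuous.comp hΓexp).clm_comp hΓexp
  have hΦin : ∀ s z w, inner ℝ (Φ s z) w
      = inner ℝ (Γ (NormedSpace.exp (s • N) z)) (Γ (NormedSpace.exp (s • N) w)) := by
    intro s z w
    simp [hΦ, ContinuousLinearMap.adjoint_inner_left]
  have hW : ∀ z w, inner ℝ ((∫ s in (0 : ℝ)..1, Φ s) z) w = ∫ s in (0 : ℝ)..1,
      inner ℝ (Γ (NormedSpace.exp (s • N) z)) (Γ (NormedSpace.exp (s • N) w)) := by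
    intro z w
    have h := ((innerSL ℝ w) ∘L (ContinuousLinearMap.apply ℝ G z)).intervalIntegral_comp_comm
      (hcont.intervalIntegrable (μ := MeasureTheory.volume) 0 1)
    simp only [ContinuousLinearMap.comp_apply, ContinuousLinearMap.apply_apply,
      innerSL_apply_apply] at h
    rw [real_inner_comm, ← h]
    refine intervalIntegral.integral_congr fun s _ => ?_
    rw [real_inner_comm, hΦin]
  have hout : ∀ z, Continuous fun s : ℝ => Γ (NormedSpace.exp (s • N) z) := fun z =>
    hΓexp.clm_apply continuous_const
  refine ⟨∫ s in (0 : ℝ)..1, Φ s, fun z w => ?_, fun z hz => ?_, fun z => ?_⟩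
  · rw [real_inner_comm _ z, hW, hW]
    simp only [real_inner_comm]
  · rw [hW]
    refine intervalIntegral.integral_pos zero_lt_one ((hout z).inner (hout z)).continuousOn
      (fun s _ => real_inner_self_nonneg) ?_
    by_contra hcon
    refine hz (eq_zero_of_output_eq_zero hobs lam fun s hs => ?_)
    by_contra hne
    exact hcon ⟨s, hs, real_inner_self_pos.2 hne⟩
  -- Integrating this derivative gives `2 * ⟪W z, N z⟫` as the squared output at time one minus that
  -- at time zero; discarding the former leaves the Lyapunov inequality.
  · have hd : ∀ s ∈ uIcc (0 : ℝ) 1, HasDerivAt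
        (fun s : ℝ => ‖Γ (NormedSpace.exp (s • N) z)‖ ^ 2)
        (2 * inner ℝ (Γ (NormedSpace.exp (s • N) z)) (Γ (NormedSpace.exp (s • N) (N z)))) s :=
      fun s _ => (hasDerivAt_comp_exp_apply Γ N z s).norm_sq
    have hint := intervalIntegral.integral_eq_sub_of_hasDerivAt hd
      ((continuous_const.mul ((hout z).inner (hout (N z)))).intervalIntegrable 0 1)
    rw [intervalIntegral.integral_const_mul, ← hW] at hint
    have hBz : (Λ + lam • 1) z = -(N z) := by simp [hN]
    rw [hBz, inner_neg_right]
    have h0 : Γ (NormedSpace.exp ((0 : ℝ) • N) z) = Γ z := by simp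
    rw [h0] at hint
    have : 0 ≤ ‖Γ (NormedSpace.exp ((1 : ℝ) • N) z)‖ ^ 2 := by positivity
    linarith

-- Minimize over the compact unit sphere and rescale.
open Metric in
theorem exists_le_inner_of_pos {W : G →L[ℝ] G} (hW : ∀ z, z ≠ 0 → 0 < inner ℝ (W z) z) :
    ∃ c > 0, ∀ z, c * ‖z‖ ^ 2 ≤ inner ℝ (W z) z := by
  rcases subsingleton_or_nontrivial G with hG | hG
  · exact ⟨1, one_pos, fun z => by simp [Subsingleton.elim z 0]⟩
  obtain ⟨z₀, hz₀, hmin⟩ := (isCompact_sphere (0 : G) 1).exists_isMinOn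
    (NormedSpace.sphere_nonempty.2 zero_le_one)
    (W.continuous.inner (𝕜 := ℝ) continuous_id).continuousOn
  have hz₀' : z₀ ≠ 0 := by
    rintro rfl
    simp at hz₀
  refine ⟨_, hW z₀ hz₀', fun z => ?_⟩
  by_cases hz : z = 0
  · simp [hz]
  have hn : 0 < ‖z‖ := norm_pos_iff.2 hz
  have h1 := hmin (show ‖z‖⁻¹ • z ∈ sphere (0 : G) 1 by
    simp [norm_smul, hn.ne'])
  simp only [id, map_smul, inner_smul_left, inner_smul_right, Set.mem_ofPred_eq,
    conj_trivial] at h1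
  have h2 : ‖z‖⁻¹ * (‖z‖⁻¹ * inner ℝ (W z) z) = inner ℝ (W z) z / ‖z‖ ^ 2 := by
    field_simp
  rwa [h2, le_div_iff₀ (by positivity)] at h1

/-- Output injection for an observable pair achieves any exponential rate. -/
theorem exists_injection_exp_decay {Γ : G →L[ℝ] H} {Λ : G →L[ℝ] G}
    (hobs : ∀ z, (∀ k : ℕ, Γ ((Λ ^ k) z) = 0) → z = 0) (lam : ℝ) :
    ∃ κ : H →L[ℝ] G, ∃ c, ∀ t : ℝ, 0 ≤ t → ∀ z,
      ‖NormedSpace.exp (t • (Λ + κ ∘L Γ)) z‖ ≤ c * Real.exp (-lam * t) * ‖z‖ := by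
  obtain ⟨W, hsym, hpos, hlyap⟩ := exists_gramian hobs lam
  obtain ⟨c, hc, hcW⟩ := exists_le_inner_of_pos hpos
  have hinj : Function.Injective (W : G →ₗ[ℝ] G) := by
    rw [injective_iff_map_eq_zero]
    intro z hz
    by_contra hne
    have := hpos z hne
    rw [show W z = 0 from hz, inner_zero_left] at this
    exact this.false
  obtain ⟨R, hR⟩ := LinearMap.exists_rightInverse_of_surjective _
    (LinearMap.range_eq_top.2 (LinearMap.injective_iff_surjective.1 hinj))
  have hWR : ∀ z, W (R z) = z := fun z => LinearMap.congr_fun hR z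
  -- The gain `-W⁻¹ Γ*` contributes `-2 * ‖Γ y‖ ^ 2` to the derivative of `⟪W y, y⟫`, outweighing
  -- the `‖Γ y‖ ^ 2` allowed by `hlyap`.
  set κ : H →L[ℝ] G := -(R.toContinuousLinearMap ∘L Γ.adjoint) with hκ
  have hWκ : ∀ y, W (κ y) = -(Γ.adjoint y) := fun y => by simp [hκ, hWR]
  refine ⟨κ, √(‖W‖ / c), fun t ht z => ?_⟩
  set M : G →L[ℝ] G := Λ + κ ∘L Γ with hM
  -- The rescaling turns decay at rate `lam` into boundedness of `y`.
  set y : ℝ → G := fun t => Real.exp (lam * t) • NormedSpace.exp (t • M) z with hy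
  have hexp : ∀ t, HasDerivAt (fun t => Real.exp (lam * t)) (lam * Real.exp (lam * t)) t :=
    fun t => ((hasDerivAt_id t).const_mul lam).exp.congr_deriv (by simp only [id]; ring)
  have hyd : ∀ t, HasDerivAt y ((Λ + lam • 1) (y t) + κ (Γ (y t))) t := by
    intro t
    refine ((hexp t).smul (hasDerivAt_exp_apply M z t)).congr_deriv ?_
    simp only [hy, hM, map_smul, add_apply, smul_apply,
      one_apply_eq_self, ContinuousLinearMap.comp_apply]
    module
  have hVd : ∀ t, HasDerivAt (fun t => inner ℝ (W (y t)) (y t))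
      (2 * inner ℝ (W (y t)) ((Λ + lam • 1) (y t) + κ (Γ (y t)))) t := by
    intro t
    refine ((W.hasFDerivAt.comp_hasDerivAt t (hyd t)).inner ℝ (hyd t)).congr_deriv ?_
    rw [hsym ((Λ + lam • 1) (y t) + κ (Γ (y t))), real_inner_comm (W (y t))]
    exact (two_mul _).symm
  have hanti : Antitone fun t => inner ℝ (W (y t)) (y t) := by
    refine antitone_of_hasDerivAt_nonpos hVd fun t => ?_
    have h1 := hlyap (y t)
    have h2 : inner ℝ (W (y t)) (κ (Γ (y t))) = -‖Γ (y t)‖ ^ 2 := by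
      rw [hsym, hWκ, inner_neg_right, ContinuousLinearMap.adjoint_inner_right,
        real_inner_self_eq_norm_sq]
    have h3 : 0 ≤ ‖Γ (y t)‖ ^ 2 := by positivity
    rw [Pi.zero_apply, inner_add_right, h2]
    linarith
  have h1 := hanti ht
  have hy0 : y 0 = z := by simp [hy]
  simp only [hy0] at h1
  have h2 : inner ℝ (W z) z ≤ ‖W‖ * ‖z‖ ^ 2 := by
    calc _ ≤ ‖W z‖ * ‖z‖ := real_inner_le_norm _ _
      _ ≤ ‖W‖ * ‖z‖ * ‖z‖ := by gcongr; exact W.le_opNorm z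
      _ = _ := by ring
  have h3 : ‖y t‖ ^ 2 ≤ ‖W‖ / c * ‖z‖ ^ 2 := by
    rw [div_mul_eq_mul_div, le_div_iff₀ hc]
    linarith [hcW (y t)]
  have h4 : ‖y t‖ ≤ √(‖W‖ / c) * ‖z‖ := by
    refine (Real.le_sqrt_of_sq_le h3).trans_eq ?_
    rw [Real.sqrt_mul (by positivity), Real.sqrt_sq (norm_nonneg z)]
  have h5 : ‖NormedSpace.exp (t • M) z‖ = Real.exp (-lam * t) * ‖y t‖ := by
    simp only [hy]
    rw [norm_smul, Real.norm_of_nonneg (Real.exp_pos _).le, ← mul_assoc, ← Real.exp_add]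
    simp
  rw [h5]
  calc _ ≤ Real.exp (-lam * t) * (√(‖W‖ / c) * ‖z‖) := by gcongr
    _ = _ := by ring

end Gramian

/-! ### Unobservable spaces, admissible gains and decay of the observable error. -/

theorem act_mul {p q r : ℕ} (M : Matrix (Fin p) (Fin q) ℝ) (N : Matrix (Fin q) (Fin r) ℝ)
    (v : EuclideanSpace ℝ (Fin r)) : act (M * N) v = act M (act N v) := by
  rw [act, Matrix.toLpLin_mul 2 2 2]
  rfl

section Unobservable

variable {p n : ℕ} {C : Matrix (Fin p) (Fin n) ℝ} {A : Matrix (Fin n) (Fin n) ℝ}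
  {v : EuclideanSpace ℝ (Fin n)}

/-- By Cayley–Hamilton every power of `A` is a combination of the first `n` powers. -/
theorem mem_unobservableSpace_iff : v ∈ unobservableSpace C A ↔ ∀ k : ℕ, act (C * A ^ k) v = 0 := by
  simp only [unobservableSpace, Submodule.mem_iInf, LinearMap.mem_ker]
  refine ⟨fun h k => ?_, fun h k => h k⟩
  rcases Nat.eq_zero_or_pos n with hn | hn
  · subst hn
    rw [Subsingleton.elim v 0, map_zero]
  have : Nonempty (Fin n) := ⟨⟨0, hn⟩⟩
  have hdeg : (Polynomial.X ^ k %ₘ A.charpoly).natDegree < n := by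
    have h1 : A.charpoly ≠ 1 := fun h1 => by
      have := A.charpoly_natDegree_eq_dim
      rw [h1, Polynomial.natDegree_one, Fintype.card_fin] at this
      omega
    have h2 := Polynomial.natDegree_modByMonic_lt (Polynomial.X ^ k) A.charpoly_monic h1
    rwa [A.charpoly_natDegree_eq_dim, Fintype.card_fin] at h2
  rw [A.pow_eq_aeval_mod_charpoly, Polynomial.aeval_eq_sum_range' hdeg, Matrix.mul_sum, act,
    map_sum, LinearMap.sum_apply]
  refine Finset.sum_eq_zero fun j hj => ?_
  have hj' := h ⟨j, Finset.mem_range.1 hj⟩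
  rw [Matrix.mul_smul, map_smul, LinearMap.smul_apply]
  simp only [act] at hj'
  rw [hj', smul_zero]

theorem act_eq_zero_of_mem_unobservableSpace (hv : v ∈ unobservableSpace C A) : act C v = 0 := by
  simpa using mem_unobservableSpace_iff.1 hv 0

theorem act_mem_unobservableSpace (hv : v ∈ unobservableSpace C A) :
    act A v ∈ unobservableSpace C A := by
  rw [mem_unobservableSpace_iff] at hv ⊢
  intro k
  rw [← act_mul, Matrix.mul_assoc, ← pow_succ]
  exact hv (k + 1)

end Unobservable

/-- An algebra isomorphism in finite dimension is continuous and commutes with the exponential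
series. This links the entrywise `ExpDecay` to operator estimates. -/
theorem exp_smul_toEuclideanCLM_apply {r : ℕ} (M : Matrix (Fin r) (Fin r) ℝ) (t : ℝ)
    (v : EuclideanSpace ℝ (Fin r)) :
    NormedSpace.exp (t • Matrix.toEuclideanCLM (n := Fin r) (𝕜 := ℝ) M) v
      = act (NormedSpace.exp (t • M)) v := by
  set Ψ := Matrix.toEuclideanCLM (n := Fin r) (𝕜 := ℝ) with hΨ
  let ψ : (EuclideanSpace ℝ (Fin r) →L[ℝ] EuclideanSpace ℝ (Fin r)) →ₗ[ℝ]
      Matrix (Fin r) (Fin r) ℝ :=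
    { toFun := Ψ.symm, map_add' := map_add Ψ.symm, map_smul' := fun c x => map_smul Ψ.symm c x }
  have hcont : Continuous ψ := ψ.continuous_of_finiteDimensional
  have h : Ψ.symm (NormedSpace.exp (t • Ψ M)) = NormedSpace.exp (t • M) := by
    rw [NormedSpace.exp_eq_tsum ℝ, NormedSpace.exp_eq_tsum ℝ]
    refine ((NormedSpace.expSeries_summable' (𝕂 := ℝ) (t • Ψ M)).map_tsum ψ hcont).trans ?_
    refine tsum_congr fun k => ?_
    change Ψ.symm _ = _
    rw [map_smul, map_pow, map_smul, StarAlgEquiv.symm_apply_apply]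
  have h2 := congrArg Ψ h
  rw [StarAlgEquiv.apply_symm_apply] at h2
  rw [h2]
  rfl

theorem norm_le_sum_abs {r : ℕ} (v : EuclideanSpace ℝ (Fin r)) : ‖v‖ ≤ ∑ a, |v a| := by
  rw [EuclideanSpace.norm_eq]
  refine Real.sqrt_le_iff.2 ⟨by positivity, ?_⟩
  simp only [Real.norm_eq_abs]
  exact Finset.sum_sq_le_sq_sum_of_nonneg fun _ _ => abs_nonneg _

theorem ExpDecay.exists_norm_exp_apply_le {r : ℕ} {M : Matrix (Fin r) (Fin r) ℝ} {lam : ℝ}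
    (h : ExpDecay M lam) (v : EuclideanSpace ℝ (Fin r)) :
    ∃ D, ∀ t : ℝ, 0 ≤ t →
      ‖NormedSpace.exp (t • Matrix.toEuclideanCLM (n := Fin r) (𝕜 := ℝ) M) v‖
        ≤ D * Real.exp (-(lam * t)) := by
  obtain ⟨c, hc⟩ := h
  refine ⟨∑ _a : Fin r, ∑ b, c * |v b|, fun t ht => ?_⟩
  rw [exp_smul_toEuclideanCLM_apply, Finset.sum_mul]
  refine (norm_le_sum_abs _).trans (Finset.sum_le_sum fun a _ => ?_)
  rw [Finset.sum_mul]
  have h1 : (act (NormedSpace.exp (t • M)) v) a = ∑ b, NormedSpace.exp (t • M) a b * v b := by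
    simp [act, Matrix.toLpLin_apply, Matrix.mulVec, dotProduct]
  rw [h1]
  refine (Finset.abs_sum_le_sum_abs _ _).trans (Finset.sum_le_sum fun b _ => ?_)
  rw [abs_mul]
  calc _ ≤ c * Real.exp (-lam * t) * |v b| := by gcongr; exact hc t ht a b
    _ = _ := by rw [neg_mul]; ring

theorem expDecay_of_norm_exp_apply_le {r : ℕ} {M : Matrix (Fin r) (Fin r) ℝ} {lam c : ℝ}
    (h : ∀ t : ℝ, 0 ≤ t → ∀ z,
      ‖NormedSpace.exp (t • Matrix.toEuclideanCLM (n := Fin r) (𝕜 := ℝ) M) z‖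
        ≤ c * Real.exp (-lam * t) * ‖z‖) : ExpDecay M lam := by
  refine ⟨c, fun t ht a b => ?_⟩
  have h1 := h t ht (EuclideanSpace.single b 1)
  rw [exp_smul_toEuclideanCLM_apply, PiLp.norm_single, norm_one, mul_one] at h1
  refine le_trans ?_ h1
  have h2 := PiLp.norm_apply_le (act (NormedSpace.exp (t • M)) (EuclideanSpace.single b 1)) a
  have h3 : (act (NormedSpace.exp (t • M)) (EuclideanSpace.single b 1)) a
      = NormedSpace.exp (t • M) a b := by
    simp [act, Matrix.toLpLin_apply]
  rwa [h3] at h2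

/-- Observer gains with any prescribed rate exist. -/
theorem exists_isObserverGain {p n : ℕ} (C : Matrix (Fin p) (Fin n) ℝ)
    (A : Matrix (Fin n) (Fin n) ℝ) (lam : ℝ) : ∃ K, IsObserverGain C A lam K := by
  set U := unobservableSpace C A with hU
  set r := Module.finrank ℝ Uᗮ with hr
  -- `Q` will take coordinates of the orthogonal projection onto `Uᗮ`, and `Qinv` will be the
  -- inclusion of `Uᗮ`.
  let b : OrthonormalBasis (Fin r) ℝ Uᗮ := stdOrthonormalBasis ℝ Uᗮ
  let L : EuclideanSpace ℝ (Fin n) →ₗ[ℝ] EuclideanSpace ℝ (Fin r) :=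
    b.repr.toLinearEquiv.toLinearMap ∘ₗ Uᗮ.orthogonalProjectionOnto.toLinearMap
  let R : EuclideanSpace ℝ (Fin r) →ₗ[ℝ] EuclideanSpace ℝ (Fin n) :=
    Uᗮ.subtype ∘ₗ b.repr.symm.toLinearEquiv.toLinearMap
  have hL : ∀ v, L v = b.repr (Uᗮ.orthogonalProjectionOnto v) := fun _ => rfl
  have hR : ∀ z, R z = (b.repr.symm z : EuclideanSpace ℝ (Fin n)) := fun _ => rfl
  have hLR : ∀ z, L (R z) = z := fun z => by rw [hL, hR]; simp
  have hRL : ∀ v, R (L v) - v ∈ U := fun v => by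
    have h1 : R (L v) = Uᗮ.starProjection v := by
      rw [hL, hR, LinearIsometryEquiv.symm_apply_apply]
      rfl
    rw [h1, Submodule.starProjection_orthogonal']
    simp [Submodule.starProjection_apply_mem]
  have hker : LinearMap.ker L = U := by
    ext v
    rw [LinearMap.mem_ker, hL, LinearIsometryEquiv.map_eq_zero_iff,
      Submodule.orthogonalProjectionOnto_eq_zero_iff, Submodule.orthogonal_orthogonal]
  set Q : Matrix (Fin r) (Fin n) ℝ := (Matrix.toLpLin 2 2).symm L with hQ
  set Qinv : Matrix (Fin n) (Fin r) ℝ := (Matrix.toLpLin 2 2).symm R with hQinv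
  have hactQ : act Q = L := LinearEquiv.apply_symm_apply _ _
  have hactR : act Qinv = R := LinearEquiv.apply_symm_apply _ _
  have hext : ∀ {a d : ℕ} {M N : Matrix (Fin a) (Fin d) ℝ}, (∀ v, act M v = act N v) → M = N :=
    fun h => (Matrix.toLpLin 2 2).injective (LinearMap.ext h)
  have hQQ : Q * Qinv = 1 := hext fun v => by
    rw [act_mul, hactQ, hactR, hLR]
    simp [act]
  have hCQ : C * Qinv * Q = C := hext fun v => by
    rw [act_mul, act_mul, hactQ, hactR]
    have := act_eq_zero_of_mem_unobservableSpace (hRL v)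
    rwa [map_sub, sub_eq_zero] at this
  have hAQ : Q * A = Q * A * Qinv * Q := hext fun v => by
    rw [act_mul, act_mul, act_mul, act_mul, hactQ, hactR]
    have h1 := act_mem_unobservableSpace (hRL v)
    rw [← hU, ← hker, LinearMap.mem_ker, map_sub, map_sub, sub_eq_zero] at h1
    exact h1.symm
  have hrank : Q.rank = r := by
    refine le_antisymm ((Matrix.rank_le_height Q)) ?_
    calc r = (1 : Matrix (Fin r) (Fin r) ℝ).rank := by simp
      _ = (Q * Qinv).rank := by rw [hQQ]
      _ ≤ Q.rank := Matrix.rank_mul_le_left _ _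
  set Cbar := C * Qinv with hCbar
  set Abar := Q * A * Qinv with hAbar
  have hpow : ∀ k : ℕ, Q * A ^ k = Abar ^ k * Q := by
    intro k
    induction k with
    | zero => simp
    | succ k ih => rw [pow_succ, ← Matrix.mul_assoc, ih, Matrix.mul_assoc, hAQ, ← Matrix.mul_assoc,
        ← pow_succ]
  -- The reduced pair is observable: an unobservable `z` lifts to `R z` in `U`, the kernel of `L`,
  -- while `L (R z) = z`.
  have hobs : ∀ z, (∀ k : ℕ, (act Cbar).toContinuousLinearMap
      ((Matrix.toEuclideanCLM (n := Fin r) (𝕜 := ℝ) Abar ^ k) z) = 0) → z = 0 := by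
    intro z hz
    have hmem : R z ∈ U := by
      rw [hU, mem_unobservableSpace_iff]
      intro k
      have h1 := hz k
      rw [← map_pow] at h1
      have h2 : act Cbar (act (Abar ^ k) z) = 0 := h1
      have h3 : C * A ^ k = Cbar * (Abar ^ k * Q) := by rw [← hpow, ← Matrix.mul_assoc, hCQ]
      rw [h3, act_mul Cbar, act_mul (Abar ^ k), hactQ, hLR]
      exact h2
    rw [← hker, LinearMap.mem_ker, hLR] at hmem
    exact hmem
  obtain ⟨κ, c, hκ⟩ := exists_injection_exp_decay hobs lam
  set Kbar : Matrix (Fin r) (Fin p) ℝ := (Matrix.toLpLin 2 2).symm (κ : _ →ₗ[ℝ] _) with hKbar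
  have hactK : act Kbar = (κ : _ →ₗ[ℝ] _) := LinearEquiv.apply_symm_apply _ _
  have hM : Matrix.toEuclideanCLM (n := Fin r) (𝕜 := ℝ) (Abar + Kbar * Cbar)
      = Matrix.toEuclideanCLM (n := Fin r) (𝕜 := ℝ) Abar
        + κ ∘L (act Cbar).toContinuousLinearMap := by
    rw [map_add]
    congr 1
    ext1 v
    have h1 : Matrix.toEuclideanCLM (n := Fin r) (𝕜 := ℝ) (Kbar * Cbar) v
        = act (Kbar * Cbar) v := rfl
    rw [h1, act_mul, hactK]
    rfl
  refine ⟨Qinv * Kbar, r, Q, Cbar, Abar, Kbar, Qinv, hrank, ?_, hCQ, hAQ, ?_, hQQ, rfl⟩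
  · rw [hactQ, hker]
  · refine expDecay_of_norm_exp_apply_le (c := c) ?_
    rw [hM]
    exact hκ

open Set in
/-- The observable part of the local error decays exponentially, whatever the adaptive gain. -/
theorem IsObserverGain.exists_decay {p n : ℕ} {C : Matrix (Fin p) (Fin n) ℝ}
    {A : Matrix (Fin n) (Fin n) ℝ} {lam : ℝ} {K : Matrix (Fin n) (Fin p) ℝ}
    (hK : IsObserverGain C A lam K) {J : Set ℝ} (hJ : J.OrdConnected) (hJ0 : J ⊆ Ici 0)
    (h0 : (0 : ℝ) ∈ J) {e y : ℝ → EuclideanSpace ℝ (Fin n)} {γ : ℝ → ℝ}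
    (he : ∀ t ∈ J, HasDerivWithinAt e (act (A + K * C) (e t)
      - γ t • (unobservableSpace C A).starProjection (y t)) (Ici 0) t) :
    ∃ D, ∀ t ∈ J, ‖e t - (unobservableSpace C A).starProjection (e t)‖
      ≤ D * Real.exp (-(lam * t)) := by
  obtain ⟨r, Q, Cbar, Abar, Kbar, Qinv, -, hker, hC, hA, hdec, hQ, rfl⟩ := hK
  set U := unobservableSpace C A with hU
  set M := Matrix.toEuclideanCLM (n := Fin r) (𝕜 := ℝ) (Abar + Kbar * Cbar) with hM
  have hmul : Q * (A + Qinv * Kbar * C) = (Abar + Kbar * Cbar) * Q := by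
    rw [Matrix.mul_add, Matrix.add_mul, hA, Matrix.mul_assoc Kbar, hC, Matrix.mul_assoc Qinv,
      ← Matrix.mul_assoc Q, hQ, Matrix.one_mul]
  -- The coupling lies in the kernel of `Q`, so `Q e` solves an autonomous linear equation free of
  -- the gain `γ`.
  have hz : ∀ t ∈ J, HasDerivWithinAt (fun t => act Q (e t)) (M (act Q (e t))) (Ici 0) t := by
    intro t ht
    refine ((act Q).toContinuousLinearMap.hasFDerivAt.comp_hasDerivWithinAt t
      (he t ht)).congr_deriv ?_
    have h1 : act Q (U.starProjection (y t)) = 0 := by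
      rw [← LinearMap.mem_ker, hker]
      exact Submodule.starProjection_apply_mem _ _
    rw [LinearMap.coe_toContinuousLinearMap', map_sub, map_smul, h1, smul_zero, sub_zero,
      ← act_mul, hmul, act_mul]
    rfl
  have hsol : EqOn (fun t => act Q (e t)) (fun t => NormedSpace.exp (t • M) (act Q (e 0))) J := by
    refine solution_unique (f := M) (fun R => ⟨‖M‖₊, M.lipschitz.lipschitzOnWith⟩) hJ hJ0 h0 hz
      (fun t _ => (hasDerivAt_exp_apply M (act Q (e 0)) t).hasDerivWithinAt) ?_
    exact (exp_zero_smul_apply M _).symm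
  obtain ⟨D, hD⟩ := hdec.exists_norm_exp_apply_le (act Q (e 0))
  set T := (act Qinv).toContinuousLinearMap with hT
  refine ⟨‖T‖ * D, fun t ht => ?_⟩
  -- Hence `e t` and `T (Q e)` have the same component in `Uᗮ`, and the former's inherits the decay
  -- of `Q e`.
  have h1 : e t - T (act Q (e t)) ∈ U := by
    rw [← hker, LinearMap.mem_ker, map_sub, hT, LinearMap.coe_toContinuousLinearMap', ← act_mul Q,
      hQ]
    simp [act]
  have h2 : e t - U.starProjection (e t) = Uᗮ.starProjection (T (act Q (e t))) := by
    have h3 := Submodule.starProjection_eq_self_iff.2 h1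
    rw [map_sub] at h3
    rw [Submodule.starProjection_orthogonal']
    simp only [sub_apply, one_apply_eq_self]
    rw [sub_eq_iff_eq_add] at h3
    rw [sub_eq_sub_iff_add_eq_add]
    rw [h3]
    abel
  rw [h2]
  calc _ ≤ ‖T (act Q (e t))‖ := Submodule.norm_starProjection_apply_le _ _
    _ ≤ ‖T‖ * ‖act Q (e t)‖ := T.le_opNorm _
    _ ≤ ‖T‖ * (D * Real.exp (-(lam * t))) := by
      gcongr
      have h3 := hsol ht
      simp only at h3
      rw [h3]
      exact hD t (hJ0 ht)
    _ = _ := by ring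

/-! ### Averaging weights and joint observability. -/

section Graph

variable {m : ℕ} {N : Digraph (Fin m)}

/-- The weight that agent `i` gives to the estimate of agent `j`. -/
noncomputable def weight (N : Digraph (Fin m)) (i j : Fin m) : ℝ :=
  if j ∈ neighbors N i then ((neighbors N i).card : ℝ)⁻¹ else 0

theorem mem_neighbors {i j : Fin m} : j ∈ neighbors N i ↔ N.Adj j i := by
  simp [neighbors]

theorem card_neighbors_pos (hself : ∀ i, N.Adj i i) (i : Fin m) :
    (0 : ℝ) < (neighbors N i).card := by
  exact_mod_cast Finset.card_pos.2 ⟨i, mem_neighbors.2 (hself i)⟩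

theorem weight_nonneg (i j : Fin m) : 0 ≤ weight N i j := by
  unfold weight
  split_ifs <;> positivity

theorem sum_weight_smul {E : Type*} [AddCommGroup E] [Module ℝ E] (i : Fin m) (v : Fin m → E) :
    ∑ j, weight N i j • v j = ((neighbors N i).card : ℝ)⁻¹ • ∑ j ∈ neighbors N i, v j := by
  simp [weight, ite_smul, Finset.sum_ite_mem, Finset.smul_sum]

theorem sum_weight (hself : ∀ i, N.Adj i i) (i : Fin m) : ∑ j, weight N i j = 1 := by
  have h := sum_weight_smul (N := N) i (fun _ => (1 : ℝ))
  have := (card_neighbors_pos hself i).ne'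
  simpa [this] using h

theorem reflTransGen_weight_pos (hself : ∀ i, N.Adj i i) (hN : StronglyConnected N) (i j : Fin m) :
    Relation.ReflTransGen (fun a b => 0 < weight N b a) i j := by
  refine Relation.ReflTransGen.mono (fun a b hab => ?_) _ _ (hN i j)
  rw [weight, if_pos (mem_neighbors.2 hab)]
  exact inv_pos.2 (card_neighbors_pos hself b)

end Graph

/-- Each row of `stack C * A ^ k` is a row of some `C i * A ^ k`. -/
theorem JointlyObservable.iInf_unobservableSpace {m n : ℕ} {s : Fin m → ℕ}
    {C : ∀ i, Matrix (Fin (s i)) (Fin n) ℝ} {A : Matrix (Fin n) (Fin n) ℝ}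
    (h : JointlyObservable C A) : ⨅ i, unobservableSpace (C i) A = ⊥ := by
  rw [eq_bot_iff, ← show unobservableSpace (stack C) A = ⊥ from h]
  intro v hv
  simp only [Submodule.mem_iInf, unobservableSpace, LinearMap.mem_ker] at hv ⊢
  intro k
  ext ⟨i, b⟩
  have := congrArg (fun w => w.ofLp b) (hv i k)
  simpa [act, Matrix.toLpLin_apply, Matrix.mulVec, dotProduct, Matrix.mul_apply, stack] using this

/-- The entries of `Vᵀ v` are the coordinates of the projection in an orthonormal basis. Thus the
adaptation law is driven by the squared norm of the projected disagreement. -/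
theorem IsOrthonormalBasisMatrix.norm_act_transpose {n d : ℕ} {V : Matrix (Fin n) (Fin d) ℝ}
    {U : Submodule ℝ (EuclideanSpace ℝ (Fin n))} (h : IsOrthonormalBasisMatrix V U)
    (v : EuclideanSpace ℝ (Fin n)) : ‖act Vᵀ v‖ = ‖U.starProjection v‖ := by
  obtain ⟨hon, hspan⟩ := h
  set b : Fin d → EuclideanSpace ℝ (Fin n) := fun k => WithLp.toLp 2 (fun a => V a k) with hb
  have hcoord : ∀ k, (act Vᵀ v) k = inner ℝ (b k) v := by
    intro k
    simp [act, Matrix.toLpLin_apply, Matrix.mulVec, dotProduct, hb, PiLp.inner_apply, mul_comm]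
  have hproj : U.starProjection v = ∑ k, (act Vᵀ v) k • b k := by
    refine Submodule.eq_starProjection_of_mem_of_inner_eq_zero (K := U) ?_ ?_
    · rw [← hspan]
      exact Submodule.sum_mem _ fun k _ =>
        Submodule.smul_mem _ _ (Submodule.subset_span ⟨k, rfl⟩)
    · rw [← hspan]
      intro w hw
      induction hw using Submodule.span_induction with
      | mem w hw =>
        obtain ⟨k, rfl⟩ := hw
        have h1 := hon.inner_left_fintype (fun k => (act Vᵀ v) k) k
        rw [inner_sub_left]
        change inner ℝ v (b k) - inner ℝ (∑ i, (act Vᵀ v) i • b i) (b k) = 0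
        rw [h1, hcoord, conj_trivial, real_inner_comm, sub_self]
      | zero => simp
      | add x y _ _ hx hy => rw [inner_add_right, hx, hy, add_zero]
      | smul a x _ hx => rw [inner_smul_right, hx, mul_zero]
  rw [← sq_eq_sq₀ (norm_nonneg _) (norm_nonneg _), hproj, ← real_inner_self_eq_norm_sq (∑ k, _),
    hon.inner_sum, EuclideanSpace.norm_sq_eq]
  simp [sq]

section Components

variable {X Y : Type*} [NormedAddCommGroup X] [NormedSpace ℝ X] [NormedAddCommGroup Y]
  [NormedSpace ℝ Y] {f : ℝ → X × Y} {f' : X × Y} {J : Set ℝ} {t : ℝ}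

theorem hasDerivWithinAt_fst (h : HasDerivWithinAt f f' J t) :
    HasDerivWithinAt (fun t => (f t).1) f'.1 J t :=
  (ContinuousLinearMap.fst ℝ X Y).hasFDerivAt.comp_hasDerivWithinAt t h

theorem hasDerivWithinAt_snd (h : HasDerivWithinAt f f' J t) :
    HasDerivWithinAt (fun t => (f t).2) f'.2 J t :=
  (ContinuousLinearMap.snd ℝ X Y).hasFDerivAt.comp_hasDerivWithinAt t h

end Components

/-! ### The closed loop: global existence and convergence. -/

section Trajectory

variable {m n : ℕ} {s d : Fin m → ℕ} {A : Matrix (Fin n) (Fin n) ℝ}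
  {C : ∀ i, Matrix (Fin (s i)) (Fin n) ℝ} {N : Digraph (Fin m)}
  {V : ∀ i, Matrix (Fin n) (Fin (d i)) ℝ} {K : ∀ i, Matrix (Fin n) (Fin (s i)) ℝ}

/-- The right-hand side of the plant, estimator and gain equations. -/
noncomputable def field (A : Matrix (Fin n) (Fin n) ℝ) (C : ∀ i, Matrix (Fin (s i)) (Fin n) ℝ)
    (N : Digraph (Fin m)) (V : ∀ i, Matrix (Fin n) (Fin (d i)) ℝ)
    (K : ∀ i, Matrix (Fin n) (Fin (s i)) ℝ)
    (u : EuclideanSpace ℝ (Fin n) × (Fin m → EuclideanSpace ℝ (Fin n)) × (Fin m → ℝ)) :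
    EuclideanSpace ℝ (Fin n) × (Fin m → EuclideanSpace ℝ (Fin n)) × (Fin m → ℝ) :=
  (act A u.1,
    fun i => act (A + K i * C i) (u.2.1 i) - act (K i) (act (C i) u.1)
      - u.2.2 i • (unobservableSpace (C i) A).starProjection
          (u.2.1 i - ((neighbors N i).card : ℝ)⁻¹ • ∑ j ∈ neighbors N i, u.2.1 j),
    fun i => ‖act (V i)ᵀ (∑ j ∈ neighbors N i, ((neighbors N i).card : ℝ)⁻¹ •
        ((u.2.1 j - u.1) - (u.2.1 i - u.1)))‖ ^ 2)

theorem contDiff_act {p q : ℕ} (M : Matrix (Fin p) (Fin q) ℝ) : ContDiff ℝ 1 (act M) :=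
  (act M).toContinuousLinearMap.contDiff

/-- Supplies the Lipschitz bounds on closed balls, compact in the finite-dimensional state space,
that `exists_global_solution` needs. -/
theorem contDiff_field : ContDiff ℝ 1 (field A C N V K) := by
  have hx : ContDiff ℝ 1 fun u : EuclideanSpace ℝ (Fin n) ×
      (Fin m → EuclideanSpace ℝ (Fin n)) × (Fin m → ℝ) => u.1 := contDiff_fst
  have hξ : ∀ i, ContDiff ℝ 1 fun u : EuclideanSpace ℝ (Fin n) ×
      (Fin m → EuclideanSpace ℝ (Fin n)) × (Fin m → ℝ) => u.2.1 i := fun i =>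
    (contDiff_apply ℝ _ i).comp (contDiff_fst.comp contDiff_snd)
  have hg : ∀ i, ContDiff ℝ 1 fun u : EuclideanSpace ℝ (Fin n) ×
      (Fin m → EuclideanSpace ℝ (Fin n)) × (Fin m → ℝ) => u.2.2 i := fun i =>
    (contDiff_apply ℝ _ i).comp (contDiff_snd.comp contDiff_snd)
  refine ((contDiff_act A).comp hx).prodMk ((contDiff_pi.2 fun i => ?_).prodMk
    (contDiff_pi.2 fun i => ?_))
  · refine (((contDiff_act _).comp (hξ i)).sub
      ((contDiff_act _).comp ((contDiff_act _).comp hx))).sub ((hg i).smul ?_)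
    exact (ContinuousLinearMap.contDiff _).comp
      ((hξ i).sub ((contDiff_const_smul _).comp (ContDiff.sum fun j _ => hξ j)))
  · refine ((contDiff_act _).comp (ContDiff.sum fun j _ => (contDiff_const_smul _).comp ?_)).norm_sq ℝ
    exact ((hξ j).sub hx).sub ((hξ i).sub hx)

/-- A trajectory of the estimator induces an error trajectory. -/
theorem isErrorTrajectory_of_field (hself : ∀ i, N.Adj i i)
    (hV : ∀ i, IsOrthonormalBasisMatrix (V i) (unobservableSpace (C i) A)) {J : Set ℝ}
    {x : ℝ → EuclideanSpace ℝ (Fin n)} {ξ : ℝ → Fin m → EuclideanSpace ℝ (Fin n)}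
    {g : ℝ → Fin m → ℝ}
    (hx : ∀ t ∈ J, HasDerivWithinAt x (field A C N V K (x t, ξ t, g t)).1 (Set.Ici 0) t)
    (hξ : ∀ i, ∀ t ∈ J, HasDerivWithinAt (fun t => ξ t i)
      ((field A C N V K (x t, ξ t, g t)).2.1 i) (Set.Ici 0) t)
    (hg : ∀ i, ∀ t ∈ J, HasDerivWithinAt (fun t => g t i)
      ((field A C N V K (x t, ξ t, g t)).2.2 i) (Set.Ici 0) t) :
    IsErrorTrajectory (weight N) (fun i => unobservableSpace (C i) A)
      (fun i => (act (A + K i * C i)).toContinuousLinearMap) J (fun t i => ξ t i - x t) g := by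
  -- The weights sum to one, so the plant state drops out of differences from averages.
  have havg : ∀ t i, (ξ t i - x t) - ∑ j, weight N i j • (ξ t j - x t)
      = ξ t i - ((neighbors N i).card : ℝ)⁻¹ • ∑ j ∈ neighbors N i, ξ t j := by
    intro t i
    simp only [smul_sub, Finset.sum_sub_distrib, ← Finset.sum_smul, sum_weight hself, one_smul,
      sum_weight_smul]
    abel
  have havg' : ∀ t i, ∑ j ∈ neighbors N i, ((neighbors N i).card : ℝ)⁻¹ •
      ((ξ t j - x t) - (ξ t i - x t))
      = -((ξ t i - x t) - ∑ j, weight N i j • (ξ t j - x t)) := by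
    intro t i
    have h1 := (card_neighbors_pos hself i).ne'
    rw [havg, ← Finset.smul_sum]
    simp only [sub_sub_sub_cancel_right, Finset.sum_sub_distrib, Finset.sum_const, smul_sub]
    rw [← Nat.cast_smul_eq_nsmul ℝ, smul_smul, inv_mul_cancel₀ h1, one_smul]
    abel
  refine ⟨fun i t ht => ((hξ i t ht).sub (hx t ht)).congr_deriv ?_,
    fun i t ht => (hg i t ht).congr_deriv ?_⟩
  · simp only [field, disagreement, havg]
    have h1 : act (A + K i * C i) (x t) = act A (x t) + act (K i) (act (C i) (x t)) := by
      rw [← act_mul, act, map_add]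
      rfl
    rw [LinearMap.coe_toContinuousLinearMap', map_sub (act (A + K i * C i)), h1]
    abel
  · simp only [field, disagreement]
    rw [havg', map_neg, norm_neg, (hV i).norm_act_transpose]

/-- Boundedness of gains and errors on an interval of existence, with the decay of the observable
parts of the errors. -/
theorem exists_gain_bound_and_decay (hm : 0 < m) (hobs : JointlyObservable C A)
    (hself : ∀ i, N.Adj i i) (hN : StronglyConnected N) {lam : ℝ} (hlam : 0 < lam)
    (hK : ∀ i, IsObserverGain (C i) A lam (K i)) {J : Set ℝ} (hJ : J.OrdConnected)
    (hJ0 : J ⊆ Set.Ici 0) (h0 : (0 : ℝ) ∈ J) {e : ℝ → Fin m → EuclideanSpace ℝ (Fin n)}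
    {g : ℝ → Fin m → ℝ}
    (h : IsErrorTrajectory (weight N) (fun i => unobservableSpace (C i) A)
      (fun i => (act (A + K i * C i)).toContinuousLinearMap) J e g) (hg : ∀ i, 0 ≤ g 0 i) :
    (∃ B, ∀ i, ∀ t ∈ J, |g t i| ≤ B) ∧
      ∃ D, ∀ i, ∀ t ∈ J, ‖e t i - (unobservableSpace (C i) A).starProjection (e t i)‖
        ≤ D * Real.exp (-(lam * t)) := by
  have : Nonempty (Fin m) := ⟨⟨0, hm⟩⟩
  have hdec := fun i => (hK i).exists_decay hJ hJ0 h0 (e := fun t => e t i)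
    (γ := fun t => g t i) (h.error i)
  choose D hD using hdec
  have hD' : ∀ i, ∀ t ∈ J, ‖e t i - (unobservableSpace (C i) A).starProjection (e t i)‖
      ≤ (∑ i, |D i|) * Real.exp (-(lam * t)) := fun i t ht => (hD i t ht).trans <| by
    gcongr
    exact (le_abs_self _).trans (Finset.single_le_sum (f := fun i => |D i|)
      (fun _ _ => abs_nonneg _) (Finset.mem_univ i))
  exact ⟨h.gain_bounded weight_nonneg (sum_weight hself) (reflTransGen_weight_pos hself hN)
    hobs.iInf_unobservableSpace hJ hJ0 h0 hg hlam hD', _, hD'⟩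

-- The a priori bound that excludes finite escape: the Lyapunov argument bounds the gains,
-- exponential growth estimates bound errors and plant, and estimates are errors plus plant state.
open Set in
theorem exists_bound_of_field (hm : 0 < m) (hobs : JointlyObservable C A)
    (hself : ∀ i, N.Adj i i) (hN : StronglyConnected N)
    (hV : ∀ i, IsOrthonormalBasisMatrix (V i) (unobservableSpace (C i) A))
    {lam : ℝ} (hlam : 0 < lam) (hK : ∀ i, IsObserverGain (C i) A lam (K i)) {T : ℝ} (hT : 0 < T)
    {u : ℝ → EuclideanSpace ℝ (Fin n) × (Fin m → EuclideanSpace ℝ (Fin n)) × (Fin m → ℝ)}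
    (hu : ∀ t ∈ Ico 0 T, HasDerivWithinAt u (field A C N V K (u t)) (Ici 0) t)
    (hg : ∀ i, 0 ≤ (u 0).2.2 i) : ∃ R, ∀ t ∈ Ico 0 T, ‖u t‖ ≤ R := by
  have hJ0 : Ico 0 T ⊆ Ici 0 := fun t ht => ht.1
  have h0 : (0 : ℝ) ∈ Ico 0 T := ⟨le_rfl, hT⟩
  have hx : ∀ t ∈ Ico 0 T, HasDerivWithinAt (fun t => (u t).1) (field A C N V K (u t)).1 (Ici 0) t :=
    fun t ht => hasDerivWithinAt_fst (hu t ht)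
  have hy : ∀ t ∈ Ico 0 T, HasDerivWithinAt (fun t => (u t).2) (field A C N V K (u t)).2 (Ici 0) t :=
    fun t ht => hasDerivWithinAt_snd (hu t ht)
  have hξ : ∀ t ∈ Ico 0 T, HasDerivWithinAt (fun t => (u t).2.1) (field A C N V K (u t)).2.1
      (Ici 0) t :=
    fun t ht => hasDerivWithinAt_fst (hy t ht)
  have hγ : ∀ t ∈ Ico 0 T, HasDerivWithinAt (fun t => (u t).2.2) (field A C N V K (u t)).2.2
      (Ici 0) t :=
    fun t ht => hasDerivWithinAt_snd (hy t ht)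
  have herr := isErrorTrajectory_of_field hself hV hx
    (fun i t ht => hasDerivWithinAt_pi.1 (hξ t ht) i)
    (fun i t ht => hasDerivWithinAt_pi.1 (hγ t ht) i)
  obtain ⟨⟨B, hB⟩, -⟩ := exists_gain_bound_and_decay hm hobs hself hN hlam hK ordConnected_Ico hJ0 h0
    herr hg
  obtain ⟨L, hL0, y, hyL⟩ := herr.exists_energy_deriv_le weight_nonneg (sum_weight hself) hB
  set W := ∑ i, ‖(u 0).2.1 i - (u 0).1‖ ^ 2 with hW
  have hW0 : 0 ≤ W := by positivity
  have hE : ∀ t ∈ Ico 0 T, ∀ i, ‖(u t).2.1 i - (u t).1‖ ≤ √(W * Real.exp (L * T)) := by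
    intro t ht i
    have h1 := le_mul_exp_of_hasDerivWithinAt_le ordConnected_Ico hJ0 h0
      (fun t ht => (hyL t ht).1) (fun t ht => (hyL t ht).2) ht
    refine Real.le_sqrt_of_sq_le ?_
    have h2 := Finset.single_le_sum (f := fun i => ‖(u t).2.1 i - (u t).1‖ ^ 2)
      (fun _ _ => sq_nonneg _) (Finset.mem_univ i)
    refine h2.trans (h1.trans ?_)
    gcongr
    exact ht.2.le
  set α := ‖(act A).toContinuousLinearMap‖ with hα
  have hX : ∀ t ∈ Ico 0 T, ‖(u t).1‖ ≤ √(‖(u 0).1‖ ^ 2 * Real.exp (2 * α * T)) := by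
    intro t ht
    have h1 := le_mul_exp_of_hasDerivWithinAt_le (L := 2 * α) ordConnected_Ico hJ0 h0
      (fun t ht => (hx t ht).norm_sq) (fun t ht => by
        have h2 : inner ℝ (u t).1 (field A C N V K (u t)).1 ≤ α * ‖(u t).1‖ ^ 2 := by
          calc _ ≤ ‖(u t).1‖ * ‖(act A).toContinuousLinearMap (u t).1‖ := real_inner_le_norm _ _
            _ ≤ ‖(u t).1‖ * (α * ‖(u t).1‖) := by
              gcongr
              exact ContinuousLinearMap.le_opNorm _ _
            _ = _ := by ring
        linarith) ht
    refine Real.le_sqrt_of_sq_le (h1.trans ?_)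
    gcongr
    exact ht.2.le
  refine ⟨max (√(‖(u 0).1‖ ^ 2 * Real.exp (2 * α * T)))
    (max (√(W * Real.exp (L * T)) + √(‖(u 0).1‖ ^ 2 * Real.exp (2 * α * T))) |B|), fun t ht => ?_⟩
  rw [Prod.norm_def, Prod.norm_def]
  refine max_le_max (hX t ht) (max_le_max ?_ ?_)
  · rw [pi_norm_le_iff_of_nonneg (by positivity)]
    intro i
    have h1 : ‖(u t).2.1 i‖ ≤ ‖(u t).2.1 i - (u t).1‖ + ‖(u t).1‖ := norm_le_norm_sub_add _ _
    exact h1.trans (add_le_add (hE t ht i) (hX t ht))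
  · rw [pi_norm_le_iff_of_nonneg (by positivity)]
    exact fun i => (hB i t ht).trans (le_abs_self B)

theorem exists_isAdaptiveTrajectory (hm : 0 < m) (hobs : JointlyObservable C A)
    (hself : ∀ i, N.Adj i i) (hN : StronglyConnected N)
    (hV : ∀ i, IsOrthonormalBasisMatrix (V i) (unobservableSpace (C i) A))
    {lam : ℝ} (hlam : 0 < lam) (hK : ∀ i, IsObserverGain (C i) A lam (K i))
    (x₀ : EuclideanSpace ℝ (Fin n)) (ξ₀ : Fin m → EuclideanSpace ℝ (Fin n)) (g₀ : Fin m → ℝ)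
    (hg₀ : ∀ i, 0 ≤ g₀ i) :
    ∃ (x : ℝ → EuclideanSpace ℝ (Fin n)) (ξ : Fin m → ℝ → EuclideanSpace ℝ (Fin n))
      (g : Fin m → ℝ → ℝ), IsAdaptiveTrajectory A C N V K x ξ g ∧
        x 0 = x₀ ∧ (∀ i, ξ i 0 = ξ₀ i) ∧ (∀ i, g i 0 = g₀ i) := by
  obtain ⟨u, hu0, hu⟩ := exists_global_solution (f := field A C N V K)
    (fun R => contDiff_field.contDiffOn.exists_lipschitzOnWith one_ne_zero
      (convex_closedBall 0 R) (isCompact_closedBall 0 R)) (x₀, ξ₀, g₀)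
    (fun T u hT hu0 hu => exists_bound_of_field hm hobs hself hN hV hlam hK hT hu
      (by rw [hu0]; exact hg₀))
  have hy : ∀ t, 0 ≤ t →
      HasDerivWithinAt (fun t => (u t).2) (field A C N V K (u t)).2 (Set.Ici 0) t :=
    fun t ht => hasDerivWithinAt_snd (hu t ht)
  refine ⟨fun t => (u t).1, fun i t => (u t).2.1 i, fun i t => (u t).2.2 i, ⟨?_, ?_, ?_⟩, ?_, ?_, ?_⟩
  · exact fun t ht =>
      hasDerivWithinAt_fst (hu t ht)
  · exact fun i t ht => hasDerivWithinAt_pi.1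
      (hasDerivWithinAt_fst (hy t ht)) i
  · exact fun i t ht => hasDerivWithinAt_pi.1
      (hasDerivWithinAt_snd (hy t ht)) i
  · simp [hu0]
  · simp [hu0]
  · simp [hu0]

theorem IsAdaptiveTrajectory.bounded_and_tendsto (hm : 0 < m) (hobs : JointlyObservable C A)
    (hself : ∀ i, N.Adj i i) (hN : StronglyConnected N)
    (hV : ∀ i, IsOrthonormalBasisMatrix (V i) (unobservableSpace (C i) A))
    {lam : ℝ} (hlam : 0 < lam) (hK : ∀ i, IsObserverGain (C i) A lam (K i))
    {x : ℝ → EuclideanSpace ℝ (Fin n)} {ξ : Fin m → ℝ → EuclideanSpace ℝ (Fin n)}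
    {g : Fin m → ℝ → ℝ} (h : IsAdaptiveTrajectory A C N V K x ξ g) (hg : ∀ i, 0 ≤ g i 0) :
    (∀ i, ∃ B : ℝ, ∀ t, 0 ≤ t → |g i t| ≤ B) ∧
      Tendsto (fun t => fun i => ξ i t - x t) atTop (𝓝 0) := by
  have : Nonempty (Fin m) := ⟨⟨0, hm⟩⟩
  have herr := isErrorTrajectory_of_field (J := Set.Ici 0) (ξ := fun t i => ξ i t)
    (g := fun t i => g i t) hself hV h.plant h.estimator h.gain
  obtain ⟨⟨B, hB⟩, D, hD⟩ := exists_gain_bound_and_decay hm hobs hself hN hlam hK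
    Set.ordConnected_Ici subset_rfl Set.self_mem_Ici herr hg
  exact ⟨fun i => ⟨B, hB i⟩, herr.tendsto_zero weight_nonneg (sum_weight hself)
    (reflTransGen_weight_pos hself hN) hobs.iInf_unobservableSpace hB hlam hD⟩

end Trajectory

end DistEst

theorem mainTheorem9 {m n : ℕ} (hm : 0 < m) {s d : Fin m → ℕ}
    (A : Matrix (Fin n) (Fin n) ℝ) (C : ∀ i, Matrix (Fin (s i)) (Fin n) ℝ)
    (hobs : DistEst.JointlyObservable C A)
    (N : Digraph (Fin m)) (hself : ∀ i, N.Adj i i) (hN : DistEst.StronglyConnected N)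
    (V : ∀ i, Matrix (Fin n) (Fin (d i)) ℝ)
    (hV : ∀ i, DistEst.IsOrthonormalBasisMatrix (V i) (DistEst.unobservableSpace (C i) A))
    (lam : ℝ) (hlam : 0 < lam) :
    (∀ i, ∃ Ki : Matrix (Fin n) (Fin (s i)) ℝ, DistEst.IsObserverGain (C i) A lam Ki) ∧
    ∀ K : ∀ i, Matrix (Fin n) (Fin (s i)) ℝ,
      (∀ i, DistEst.IsObserverGain (C i) A lam (K i)) →
      (∀ (x₀ : EuclideanSpace ℝ (Fin n)) (ξ₀ : Fin m → EuclideanSpace ℝ (Fin n))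
          (g₀ : Fin m → ℝ), (∀ i, 0 ≤ g₀ i) →
          ∃ (x : ℝ → EuclideanSpace ℝ (Fin n)) (ξ : Fin m → ℝ → EuclideanSpace ℝ (Fin n))
            (g : Fin m → ℝ → ℝ),
            DistEst.IsAdaptiveTrajectory A C N V K x ξ g ∧
            x 0 = x₀ ∧ (∀ i, ξ i 0 = ξ₀ i) ∧ (∀ i, g i 0 = g₀ i)) ∧
      (∀ (x : ℝ → EuclideanSpace ℝ (Fin n)) (ξ : Fin m → ℝ → EuclideanSpace ℝ (Fin n))
          (g : Fin m → ℝ → ℝ),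
          DistEst.IsAdaptiveTrajectory A C N V K x ξ g → (∀ i, 0 ≤ g i 0) →
          (∀ i, ∃ B : ℝ, ∀ t, 0 ≤ t → |g i t| ≤ B) ∧
          Tendsto (fun t => fun i => ξ i t - x t) atTop (𝓝 0)) := by
  refine ⟨fun i => DistEst.exists_isObserverGain (C i) A lam, fun K hK => ⟨?_, ?_⟩⟩
  · exact DistEst.exists_isAdaptiveTrajectory hm hobs hself hN hV hlam hK
  · exact fun x ξ g h hg => h.bounded_and_tendsto hm hobs hself hN hV hlam hK hg
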